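/- Let $K\ge 1$ be an integer and let $X$ be the rooted $K$-ary tree (every vertex has exactly $K$ children) with root $0$, regarded as a metric graph in which each edge is an isometric copy of the unit interval. Write $|x|$ for the distance from $0$ to $x\in X$ in this unit edge length, $d|x|$ for the length element on $X$, $[z,y]$ for the geodesic from $z$ to $y$, and $j(x)=\lceil |x|\rceil$. Let $\lambda,\mu:[0,\infty)\to(0,\infty)$ be locally integrable, write $\lambda(x)=\lambda(|x|)$ and $\mu(x)=\mu(|x|)$, and equip $X$ with the measure $d\mu(x)=\mu(|x|)\,d|x|$ and the distance $d(z,y)=\int_{[z,y]}ds$, where $ds(x)=\lambda(|x|)\,d|x|$. Assume that $X$ has infinite diameter with respect to $d$. Put $B(x,r)=\{y\in X: d(x,y)<r\}$ and $F(x,r)=\{y\in X: x\in[0,y],\ d(x,y)<r\}$. For $x\in X$ and $r>0$ let $\bar x^r$ be the point of $[0,x]$ with $d(\bar x^r,x)=\min\{r,d(0,x)\}$, and let $\underline x_r$ be any point with $x\in[0,\underline x_r]$ and $d(x,\underline x_r)=r$. Let $1\le p<\infty$. For $p>1$ define $$A_p(x,r)=\frac{\mu(F(\bar x^r,2r))}{2r}\left(\frac1r\int_{[x,\underline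 x_r]}\left(\frac{K^{j(w)-j(x)}\mu(w)}{\lambda(w)}\right)^{\frac1{1-p}}ds(w)\right)^{p-1},$$ and define $$A_1(x,r)=\frac{\mu(F(\bar x^r,2r))}{2r}\cdot\operatorname*{ess\,sup}_{w\in[x,\underline x_r]}\frac{\lambda(w)}{K^{j(w)-j(x)}\mu(w)};$$ these are elements of $(0,\infty]$ and do not depend on the choice of $\underline x_r$. The measure $\mu$ satisfies the $A_p$-condition if $\sup\{A_p(x,r): x\in X,\ r>0\}<\infty$, and it satisfies the $A_p$-condition far from $0$ if $\sup\{A_p(x,r): x\in X,\ 0<r\le 8\,d(0,x)\}<\infty$. The measure $\mu$ is called $p$-admissible if the following two conditions hold. * (Doubling) There is $C_d>0$ such that $\mu(B(x,2r))\le C_d\,\mu(B(x,r))$ for all $x\in X$ and $r>0$. * ($(1,p)$-Poincaré inequality) There are $C_P>0$ and $\sigma\ge1$ such that for all $x\in X$ and $r>0$, every $u:X\to\mathbb R$ that is integrable on $B(x,\sigma r)$, and every upper gradient $g$ of $u$ (a Borel function $g:X\to[0,\infty]$ with $|u(z)-u(y)|\le\int_{[z,y]}g\,ds$ for all $z,y\in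 X$), $$\frac1{\mu(B(x,r))}\int_{B(x,r)}|u-u_{B(x,r)}|\,d\mu\le C_P\,r\left(\frac1{\mu(B(x,\sigma r))}\int_{B(x,\sigma r)}g^p\,d\mu\right)^{1/p},\qquad u_B=\frac1{\mu(B)}\int_Bu\,d\mu.$$ Then: 1. If $K=1$, then $\mu$ is $p$-admissible if and only if $\mu$ satisfies the $A_p$-condition far from $0$. 2. If $K\ge2$, then $\mu$ is $p$-admissible if and only if $\mu$ satisfies the $A_p$-condition. -/

import Mathlib

open MeasureTheory Set
open scoped ENNReal

noncomputable section

/-- The vertices of the rooted `K`-ary tree: finite words over a `K`-letter alphabet. The root is the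
empty word and the `K` children of `v` are the words obtained by appending one letter to `v`. -/
abbrev TreeVertex (K : ℕ) : Type := List (Fin K)

instance (K : ℕ) : MeasurableSpace (TreeVertex K) := ⊤

instance (K : ℕ) : DiscreteMeasurableSpace (TreeVertex K) := ⟨fun _ => trivial⟩

/-- The rooted `K`-ary tree as a metric graph with edges of unit length. A point `x` is determined by
`height = |x|`, its distance to the root in the unit edge length, and by `vertex`, the first vertex
at or below `x`; so `vertex` has generation `⌈|x|⌉`. The half-open edge from the parent of a vertex
`v ≠ []` (excluded) to `v` (included) is the set of points with `vertex = v`, and their heights run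
through the interval `(v.length - 1, v.length]`. -/
@[ext] structure RegularTree (K : ℕ) where
  vertex : TreeVertex K
  height : ℝ
  height_nonneg : 0 ≤ height
  length_vertex : vertex.length = ⌈height⌉₊

namespace RegularTree

variable {K : ℕ}

/-- The root `0`. -/
def root (K : ℕ) : RegularTree K := ⟨[], 0, le_rfl, by simp⟩

/-- `x ≤ y` if the geodesic from the root to `y` passes through `x`. -/
instance : PartialOrder (RegularTree K) where
  le x y := x.height ≤ y.height ∧ x.vertex <+: y.vertex
  le_refl x := ⟨le_rfl, List.prefix_refl _⟩
  le_trans x y z hxy hyz := ⟨hxy.1.trans hyz.1, hxy.2.trans hyz.2⟩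
  le_antisymm x y hxy hyx := by
    have h := le_antisymm hxy.1 hyx.1
    refine RegularTree.ext ?_ h
    exact hxy.2.eq_of_length (by rw [x.length_vertex, y.length_vertex, h])

/-- The smallest integer `j(x)` with `j(x) ≥ |x|`. -/
def generation (x : RegularTree K) : ℕ := ⌈x.height⌉₊

/-- The geodesic `[z, y]`: the points on `[0, z] ∪ [0, y]` that lie at or below all common
ancestors of `z` and `y`. -/
def geodesic (z y : RegularTree K) : Set (RegularTree K) :=
  {w | (w ≤ z ∨ w ≤ y) ∧ ∀ a, a ≤ z → a ≤ y → a ≤ w}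

/-- The edge containing a point, and the position of the point on this edge. -/
def coords (x : RegularTree K) : TreeVertex K × ℝ := (x.vertex, x.height)

/-- The Borel σ-algebra: there are countably many half-open edges, each of them is a Borel set, and
a set is Borel if and only if it meets each of them in a Borel set. -/
instance : MeasurableSpace (RegularTree K) := MeasurableSpace.comap coords inferInstance

theorem coords_injective : Function.Injective (coords (K := K)) := fun x y h => by
  simp only [coords, Prod.mk.injEq] at h
  exact RegularTree.ext h.1 h.2

theorem range_coords : range (coords (K := K)) = {q | 0 ≤ q.2 ∧ q.1.length = ⌈q.2⌉₊} := by
  ext ⟨v, t⟩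
  constructor
  · rintro ⟨w, hw⟩
    simp only [coords, Prod.mk.injEq] at hw
    obtain ⟨rfl, rfl⟩ := hw
    exact ⟨w.height_nonneg, w.length_vertex⟩
  · rintro ⟨h1, h2⟩
    exact ⟨⟨v, t, h1, h2⟩, rfl⟩

theorem measurableEmbedding_coords : MeasurableEmbedding (coords (K := K)) := by
  refine ⟨coords_injective, fun s hs => ⟨s, hs, rfl⟩, ?_⟩
  rintro _ ⟨t, ht, rfl⟩
  rw [image_preimage_eq_inter_range, range_coords]
  refine ht.inter ?_
  refine (measurableSet_le measurable_const measurable_snd).inter ?_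
  refine measurableSet_eq_fun ?_ ?_
  · exact (measurable_from_top (f := fun v : TreeVertex K => v.length)).comp measurable_fst
  · exact Nat.measurable_ceil.comp measurable_snd

/-- The length element `d|x|`, that is, Lebesgue measure on each edge: the restriction to the tree
of the product of counting measure on the edges with Lebesgue measure. -/
def lengthMeasure (K : ℕ) : Measure (RegularTree K) :=
  Measure.comap coords ((Measure.count : Measure (TreeVertex K)).prod (volume : Measure ℝ))

/-- The radial measure `f(|x|) d|x|`. -/
def radialMeasure (K : ℕ) (f : ℝ → ℝ) : Measure (RegularTree K) :=
  (lengthMeasure K).withDensity fun x => ENNReal.ofReal (f x.height)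

/-- The distance `d(z, y) = ∫_[z, y] ds` with `ds = lam(|x|) d|x|`. -/
def treeDist (lam : ℝ → ℝ) (z y : RegularTree K) : ℝ :=
  (radialMeasure K lam (geodesic z y)).toReal

/-- The open ball `B(x, r)` of the metric `d`. -/
def treeBall (lam : ℝ → ℝ) (x : RegularTree K) (r : ℝ) : Set (RegularTree K) :=
  {y | treeDist lam x y < r}

/-- The downward directed half ball `F(x, r)`. -/
def halfBall (lam : ℝ → ℝ) (x : RegularTree K) (r : ℝ) : Set (RegularTree K) :=
  {y | x ≤ y ∧ treeDist lam x y < r}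

/-- The tree has infinite diameter with respect to `d`. -/
def InfiniteDiameter (K : ℕ) (lam : ℝ → ℝ) : Prop :=
  ¬ BddAbove (range fun q : RegularTree K × RegularTree K => treeDist lam q.1 q.2)

/-- `g` is an upper gradient of `u` with respect to `d`. -/
def IsUpperGradient (lam : ℝ → ℝ) (g : RegularTree K → ℝ≥0∞) (u : RegularTree K → ℝ) : Prop :=
  Measurable g ∧ ∀ z y : RegularTree K,
    ENNReal.ofReal |u z - u y| ≤ ∫⁻ w in geodesic z y, g w ∂(radialMeasure K lam)

/-- The measure `dμ = mu(|x|) d|x|` is doubling on `(X, d)`. -/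
def IsDoublingTree (K : ℕ) (lam mu : ℝ → ℝ) : Prop :=
  ∃ C : ℝ, 0 < C ∧ ∀ (x : RegularTree K) (r : ℝ), 0 < r →
    radialMeasure K mu (treeBall lam x (2 * r)) ≤
      ENNReal.ofReal C * radialMeasure K mu (treeBall lam x r)

/-- `(X, d, μ)` supports a `(1, p)`-Poincaré inequality. -/
def SupportsPoincare (K : ℕ) (lam mu : ℝ → ℝ) (p : ℝ) : Prop :=
  ∃ C σ : ℝ, 0 < C ∧ 1 ≤ σ ∧ ∀ (x : RegularTree K) (r : ℝ), 0 < r →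
    ∀ (u : RegularTree K → ℝ) (g : RegularTree K → ℝ≥0∞),
      IntegrableOn u (treeBall lam x (σ * r)) (radialMeasure K mu) → IsUpperGradient lam g u →
      ENNReal.ofReal (⨍ y in treeBall lam x r,
          |u y - ⨍ z in treeBall lam x r, u z ∂(radialMeasure K mu)| ∂(radialMeasure K mu)) ≤
        ENNReal.ofReal (C * r) *
          (⨍⁻ y in treeBall lam x (σ * r), g y ^ p ∂(radialMeasure K mu)) ^ (1 / p)

/-- `μ` is `p`-admissible. -/
def IsAdmissible (K : ℕ) (lam mu : ℝ → ℝ) (p : ℝ) : Prop :=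
  IsDoublingTree K lam mu ∧ SupportsPoincare K lam mu p

instance : Nonempty (RegularTree K) := ⟨root K⟩

/-- The (unique) point of `[0, x]` at distance `min {r, d(0, x)}` from `x`. -/
def upPoint (lam : ℝ → ℝ) (x : RegularTree K) (r : ℝ) : RegularTree K :=
  Classical.epsilon fun a => a ≤ x ∧ treeDist lam a x = min r (treeDist lam (root K) x)

/-- A point `y` with `x ∈ [0, y]` at distance `r` from `x`; it exists when the diameter is infinite,
and the choice is irrelevant because `lam` and `mu` are radial. -/
def downPoint (lam : ℝ → ℝ) (x : RegularTree K) (r : ℝ) : RegularTree K :=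
  Classical.epsilon fun y => x ≤ y ∧ treeDist lam x y = r

/-- The density `K ^ (j(w) - j(x)) μ(w) / λ(w)`. -/
def branchDensity (lam mu : ℝ → ℝ) (x w : RegularTree K) : ℝ :=
  (K : ℝ) ^ ((w.generation : ℤ) - (x.generation : ℤ)) * mu w.height / lam w.height

/-- The quantity `A_p(x, r)`, with values in `[0, ∞]`. -/
def apQuantity (lam mu : ℝ → ℝ) (p : ℝ) (x : RegularTree K) (r : ℝ) : ℝ≥0∞ :=
  radialMeasure K mu (halfBall lam (upPoint lam x r) (2 * r)) / ENNReal.ofReal (2 * r) *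
    if p = 1 then
      essSup (fun w => ENNReal.ofReal (1 / branchDensity lam mu x w))
        ((radialMeasure K lam).restrict (geodesic x (downPoint lam x r)))
    else
      (ENNReal.ofReal (1 / r) * ∫⁻ w in geodesic x (downPoint lam x r),
        ENNReal.ofReal (branchDensity lam mu x w ^ (1 / (1 - p))) ∂(radialMeasure K lam)) ^ (p - 1)

/-- The `A_p`-condition. -/
def SatisfiesAp (K : ℕ) (lam mu : ℝ → ℝ) (p : ℝ) : Prop :=
  (⨆ (x : RegularTree K) (r : ℝ) (_ : 0 < r), apQuantity lam mu p x r) < ∞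

/-- The `A_p`-condition far from the root. -/
def SatisfiesApFarFromRoot (K : ℕ) (lam mu : ℝ → ℝ) (p : ℝ) : Prop :=
  (⨆ (x : RegularTree K) (r : ℝ) (_ : 0 < r ∧ r ≤ 8 * treeDist lam (root K) x),
    apQuantity lam mu p x r) < ∞

end RegularTree

end

noncomputable section

namespace RegularTree

variable {K : ℕ} {f lam mu : ℝ → ℝ} {p : ℝ} {C D : ℝ≥0∞}

/-! The pivot is an inequality along the branches, `HardyBound`: for every measurable g ≥ 0,
(∫_{F(x,r)} K^{j(x)-j(w)} g ds)^p · μ(F(x̄^r,2r)) ≤ C r^p ∫_{F(x,r)} g^p dμ. The weight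
K^{j(x)-j(w)} averages over the points of one height below x. After this averaging the left integral
lives on a single geodesic, and the density of μ against ds becomes K^{j(w)-j(x)} μ/λ, the one that
occurs in A_p.

From A_p to admissibility. A bound on A_p(x,r) yields the Hardy bound by Hölder, or by the essential
supremum when p = 1 (`hardyBound_of_apQuantity_le`). Testing it with the indicator of a smaller half
ball gives doubling (`measure_treeBall_two_mul_le`). For Poincaré, |u(y) - u(c)| is at most the
integral of g over [c,y]; Fubini, and the fact that the points of one height below c split the mass
of F(c,r) equally, bound the mean of |u - u(c)| by the left side of the Hardy bound. If the half
ball at c is not covered by the far condition (K = 1 and the ball close to 0), c is moved to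
distance r from 0 and the segment [0,c] is split dyadically towards 0; each piece is far from 0
relative to its length (`lintegral_Iic_le`).

From admissibility to A_p. The Poincaré inequality is tested with u(z) = ∫_{[0,z]} g ds, where g is
a radial φ supported in one branch below x, at distances at most r from x. On a ball further down
that branch u equals the whole integral of φ, and on a ball off the branch u is 0; by doubling both
balls have mass comparable to B(x,2r). This gives a Hardy inequality for φ on the geodesic
(`lintegral_rpow_mul_measure_le`), and the extremal φ of Hölder's inequality recovers the second
factor of A_p (`mul_dualFactor_le`).

The two values of K differ only in where the second ball comes from. For x far from 0 it lies above
x. Near 0 it must lie in another branch at 0, which needs K ≥ 2. Hence both cases run under the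
common condition `2 ≤ K ∨ r ≤ 8 * arc lam x.height`. -/

instance sfinite_lengthMeasure : SFinite (lengthMeasure K) := by
  have h : SigmaFinite (Measure.map coords (lengthMeasure K)) := by
    rw [lengthMeasure, measurableEmbedding_coords.map_comap]; infer_instance
  have : SigmaFinite (lengthMeasure K) :=
    SigmaFinite.of_map _ measurableEmbedding_coords.measurable.aemeasurable h
  infer_instance

instance sfinite_radialMeasure (f : ℝ → ℝ) : SFinite (radialMeasure K f) := by
  unfold radialMeasure; infer_instance

/-! ### Measurability, and radial integrals as integrals over the half-line -/

theorem measurable_height : Measurable (height : RegularTree K → ℝ) :=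
  measurable_snd.comp measurableEmbedding_coords.measurable

theorem measurable_vertex : Measurable (vertex : RegularTree K → TreeVertex K) :=
  measurable_fst.comp measurableEmbedding_coords.measurable

theorem measurable_generation : Measurable (generation : RegularTree K → ℕ) :=
  Nat.measurable_ceil.comp measurable_height

theorem measurableSet_le_pair :
    MeasurableSet {q : RegularTree K × RegularTree K | q.1 ≤ q.2} := by
  have h1 : MeasurableSet {q : RegularTree K × RegularTree K | q.1.height ≤ q.2.height} :=
    measurableSet_le (measurable_height.comp measurable_fst) (measurable_height.comp measurable_snd)
  have h2 : MeasurableSet {q : RegularTree K × RegularTree K | q.1.vertex <+: q.2.vertex} :=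
    ((measurable_vertex.comp measurable_fst).prodMk (measurable_vertex.comp measurable_snd))
      (MeasurableSet.of_discrete (s := {p : TreeVertex K × TreeVertex K | p.1 <+: p.2}))
  exact h1.inter h2

theorem measurableSet_Iic_tree (y : RegularTree K) : MeasurableSet (Iic y) :=
  measurableSet_le_pair.preimage (measurable_id.prodMk measurable_const)

theorem measurableSet_Ici_tree (x : RegularTree K) : MeasurableSet (Ici x) :=
  measurableSet_le_pair.preimage (measurable_const.prodMk measurable_id)

/-- The measure `f(t) dt` on the half-line `[0, ∞)`. -/
def lineMeasure (f : ℝ → ℝ) : Measure ℝ :=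
  (volume.restrict (Ici 0)).withDensity fun t => ENNReal.ofReal (f t)

instance sfinite_lineMeasure (f : ℝ → ℝ) : SFinite (lineMeasure f) := by
  unfold lineMeasure; infer_instance

instance nullSingletonClass_lineMeasure (f : ℝ → ℝ) : NullSingletonClass (lineMeasure f) := by
  unfold lineMeasure; infer_instance

/-- Tonelli for the product of counting and Lebesgue measure, integrating over the edges first: at
height t exactly the edges ending in generation ⌈t⌉ are met. All later integrals over the tree
reduce to this formula. -/
theorem lintegral_radialMeasure {f : ℝ → ℝ} (hf : Measurable f)
    {G : TreeVertex K × ℝ → ℝ≥0∞} (hG : Measurable G) :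
    ∫⁻ x, G (coords x) ∂(radialMeasure K f) =
      ∫⁻ t in Ici 0, ∑' v : TreeVertex K, (if v.length = ⌈t⌉₊ then G (v, t) else 0)
        ∂(lineMeasure f) := by
  have hf' : Measurable fun t => ENNReal.ofReal (f t) := hf.ennreal_ofReal
  have hR : MeasurableSet (range (coords (K := K))) := measurableEmbedding_coords.measurableSet_range
  have hH : Measurable fun q : TreeVertex K × ℝ => ENNReal.ofReal (f q.2) * G q :=
    (hf'.comp measurable_snd).mul hG
  have h1 : ∫⁻ x, G (coords x) ∂(radialMeasure K f) =
      ∫⁻ x, (fun q : TreeVertex K × ℝ => ENNReal.ofReal (f q.2) * G q) (coords x)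
        ∂(lengthMeasure K) := by
    exact lintegral_withDensity_eq_lintegral_mul _ (hf'.comp measurable_height)
      (hG.comp measurableEmbedding_coords.measurable)
  rw [h1, ← measurableEmbedding_coords.lintegral_map
      (fun q : TreeVertex K × ℝ => ENNReal.ofReal (f q.2) * G q), lengthMeasure,
    measurableEmbedding_coords.map_comap, ← lintegral_indicator hR,
    lintegral_prod_symm _ (hH.indicator hR).aemeasurable]
  have hT : Measurable fun t : ℝ =>
      ∑' v : TreeVertex K, (if v.length = ⌈t⌉₊ then G (v, t) else 0) := by
    refine Measurable.tsum fun v => Measurable.ite ?_ ?_ measurable_const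
    · exact measurableSet_eq_fun measurable_const Nat.measurable_ceil
    · exact hG.comp (measurable_const.prodMk measurable_id)
  rw [lineMeasure, restrict_withDensity measurableSet_Ici,
    Measure.restrict_restrict measurableSet_Ici, inter_self,
    lintegral_withDensity_eq_lintegral_mul _ hf' hT, ← lintegral_indicator measurableSet_Ici]
  refine lintegral_congr fun t => ?_
  rw [lintegral_count]
  by_cases ht : t ∈ Ici (0 : ℝ)
  · rw [indicator_of_mem ht, Pi.mul_apply, ← ENNReal.tsum_mul_left]
    refine tsum_congr fun v => ?_
    by_cases hv : v.length = ⌈t⌉₊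
    · rw [if_pos hv, indicator_of_mem]
      rw [range_coords]; exact ⟨ht, hv⟩
    · rw [if_neg hv, indicator_of_notMem, mul_zero]
      rw [range_coords]; exact fun h => hv h.2
  · rw [indicator_of_notMem ht, ENNReal.tsum_eq_zero]
    intro v
    rw [indicator_of_notMem]
    rw [range_coords]; exact fun h => ht h.1

theorem lineMeasure_restrict_of_subset {f : ℝ → ℝ} {s : Set ℝ} (hs : MeasurableSet s)
    (h : s ⊆ Ici 0) :
    (lineMeasure f).restrict s =
      (volume.restrict s).withDensity fun t => ENNReal.ofReal (f t) := by
  rw [lineMeasure, restrict_withDensity hs, Measure.restrict_restrict hs, inter_eq_left.2 h]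

/-- Integrals of radial functions over a geodesic from the root. -/
theorem setLIntegral_Iic {f : ℝ → ℝ} (hf : Measurable f) {φ : ℝ → ℝ≥0∞} (hφ : Measurable φ)
    (y : RegularTree K) :
    ∫⁻ w in Iic y, φ w.height ∂(radialMeasure K f) =
      ∫⁻ t in Icc 0 y.height, φ t ∂(lineMeasure f) := by
  let A : Set (TreeVertex K × ℝ) := {q | q.2 ≤ y.height ∧ q.1 <+: y.vertex}
  have hA : MeasurableSet A :=
    (measurableSet_le measurable_snd measurable_const).inter
      (measurable_fst (MeasurableSet.of_discrete (s := {v : TreeVertex K | v <+: y.vertex})))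
  have := lintegral_radialMeasure hf ((hφ.comp measurable_snd).indicator hA)
  rw [← lintegral_indicator (measurableSet_Iic_tree y)]
  refine Eq.trans ?_ (this.trans ?_)
  · rfl
  · rw [← Ici_inter_Iic, ← Measure.restrict_restrict_of_subset (t := Ici 0) inter_subset_left,
      inter_comm, ← Measure.restrict_restrict measurableSet_Iic,
      ← lintegral_indicator measurableSet_Iic,
      Measure.restrict_restrict measurableSet_Ici, inter_self]
    refine setLIntegral_congr_fun measurableSet_Ici fun t ht => ?_
    have ht : 0 ≤ t := ht
    by_cases hty : t ≤ y.height
    · rw [indicator_of_mem (show t ∈ Iic y.height from hty)]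
      have hl : (y.vertex.take ⌈t⌉₊).length = ⌈t⌉₊ := by
        rw [List.length_take, y.length_vertex]
        exact min_eq_left (Nat.ceil_mono hty)
      -- The segment from the root to y has one point at each height; its vertex is the prefix of
      -- length ⌈t⌉.
      rw [tsum_eq_single (y.vertex.take ⌈t⌉₊)]
      · rw [if_pos hl, indicator_of_mem]
        · rfl
        · exact ⟨hty, List.take_prefix _ _⟩
      · intro v hv
        split_ifs with h
        · rw [indicator_of_notMem]
          intro hm
          exact hv (by rw [← h]; exact List.prefix_iff_eq_take.1 hm.2)
        · rfl
    · rw [indicator_of_notMem (show t ∉ Iic y.height from hty), ENNReal.tsum_eq_zero]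
      intro v
      split_ifs with h
      · rw [indicator_of_notMem]; exact fun hm => hty hm.1
      · rfl

theorem encard_extensions (v : TreeVertex K) (n : ℕ) :
    {w : TreeVertex K | w.length = v.length + n ∧ v <+: w}.encard = (K : ℕ∞) ^ n := by
  have e : {w : TreeVertex K | w.length = v.length + n ∧ v <+: w} =
      (fun l : List.Vector (Fin K) n => v ++ l.1) '' univ := by
    ext w
    simp only [mem_ofPred_eq, image_univ, mem_range]
    constructor
    · rintro ⟨h, l, rfl⟩
      exact ⟨⟨l, by simpa using h⟩, rfl⟩
    · rintro ⟨l, rfl⟩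
      exact ⟨by simp, List.prefix_append _ _⟩
  rw [e, InjOn.encard_image, encard_univ, ENat.card_eq_coe_fintype_card, card_vector,
    Fintype.card_fin, Nat.cast_pow]
  intro a _ b _ h
  exact Subtype.ext (List.append_cancel_left h)

theorem tsum_extensions (v : TreeVertex K) {m : ℕ} (hm : v.length ≤ m) (c : ℝ≥0∞) :
    ∑' w : TreeVertex K, (if w.length = m ∧ v <+: w then c else 0) =
      (K : ℝ≥0∞) ^ (m - v.length) * c := by
  have h := encard_extensions v (m - v.length)
  rw [Nat.add_sub_cancel' hm] at h
  have : ∑' w : TreeVertex K, (if w.length = m ∧ v <+: w then c else 0) =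
      ∑' w : TreeVertex K, {w : TreeVertex K | w.length = m ∧ v <+: w}.indicator (fun _ => c) w := by
    refine tsum_congr fun w => ?_
    by_cases hw : w.length = m ∧ v <+: w <;> simp [indicator, hw]
  rw [this, ← tsum_subtype, ENNReal.tsum_set_const, h]
  simp

/-- Integrals of radial functions over the part of the tree below a point. -/
theorem setLIntegral_Ici {f : ℝ → ℝ} (hf : Measurable f) {φ : ℝ → ℝ≥0∞} (hφ : Measurable φ)
    (x : RegularTree K) :
    ∫⁻ w in Ici x, φ w.height ∂(radialMeasure K f) =
      ∫⁻ t in Ici x.height, (K : ℝ≥0∞) ^ (⌈t⌉₊ - x.generation) * φ t ∂(lineMeasure f) := by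
  let A : Set (TreeVertex K × ℝ) := {q | x.height ≤ q.2 ∧ x.vertex <+: q.1}
  have hA : MeasurableSet A :=
    (measurableSet_le measurable_const measurable_snd).inter
      (measurable_fst (MeasurableSet.of_discrete (s := {v : TreeVertex K | x.vertex <+: v})))
  have := lintegral_radialMeasure hf ((hφ.comp measurable_snd).indicator hA)
  rw [← lintegral_indicator (measurableSet_Ici_tree x)]
  refine Eq.trans ?_ (this.trans ?_)
  · rfl
  · rw [← lintegral_indicator measurableSet_Ici, ← lintegral_indicator measurableSet_Ici]
    refine lintegral_congr fun t => ?_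
    by_cases ht : x.height ≤ t
    · have h0 : (0 : ℝ) ≤ t := x.height_nonneg.trans ht
      rw [indicator_of_mem (show t ∈ Ici (0 : ℝ) from h0),
        indicator_of_mem (show t ∈ Ici x.height from ht), generation, ← x.length_vertex,
        ← tsum_extensions x.vertex (by rw [x.length_vertex]; exact Nat.ceil_mono ht)]
      refine tsum_congr fun v => ?_
      by_cases hv : v.length = ⌈t⌉₊
      · by_cases hp : x.vertex <+: v
        · rw [if_pos hv, if_pos ⟨hv, hp⟩, indicator_of_mem]
          · rfl
          · exact ⟨ht, hp⟩
        · rw [if_pos hv, if_neg (fun h => hp h.2), indicator_of_notMem]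
          exact fun h => hp h.2
      · rw [if_neg hv, if_neg (fun h => hv h.1)]
    · rw [indicator_of_notMem (show t ∉ Ici x.height from ht)]
      by_cases h0 : (0 : ℝ) ≤ t
      · rw [indicator_of_mem (show t ∈ Ici (0 : ℝ) from h0), ENNReal.tsum_eq_zero]
        intro v
        split_ifs with h
        · rw [indicator_of_notMem]; exact fun hm => ht hm.1
        · rfl
      · rw [indicator_of_notMem (show t ∉ Ici (0 : ℝ) from h0)]

/-! ### Weights on the half-line and their primitives -/

/-- Measurable, positive and locally integrable weights on the half-line. -/
structure IsWeight (f : ℝ → ℝ) : Prop where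
  measurable : Measurable f
  pos : ∀ t, 0 < f t
  locallyIntegrableOn : LocallyIntegrableOn f (Ici 0)

/-- The mass of `[0, t]` for the measure `f(t) dt`. -/
def arc (f : ℝ → ℝ) (t : ℝ) : ℝ := (lineMeasure f (Icc 0 t)).toReal

theorem arc_nonneg (f : ℝ → ℝ) (t : ℝ) : 0 ≤ arc f t := ENNReal.toReal_nonneg

theorem arc_zero (f : ℝ → ℝ) : arc f 0 = 0 := by simp [arc]

theorem IsWeight.lineMeasure_Icc_lt_top (hf : IsWeight f) (t : ℝ) :
    lineMeasure f (Icc 0 t) < ∞ := by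
  have h : IntegrableOn f (Icc 0 t) :=
    hf.locallyIntegrableOn.integrableOn_compact_subset Icc_subset_Ici_self isCompact_Icc
  rw [← Measure.restrict_apply_univ,
    lineMeasure_restrict_of_subset measurableSet_Icc Icc_subset_Ici_self,
    withDensity_apply _ MeasurableSet.univ, Measure.restrict_univ]
  refine lt_of_le_of_lt (lintegral_mono fun t => ?_) h.2
  rw [← ofReal_norm]
  exact ENNReal.ofReal_le_ofReal (Real.le_norm_self _)

theorem IsWeight.lineMeasure_eq_zero_iff (hf : IsWeight f) {s : Set ℝ} :
    lineMeasure f s = 0 ↔ volume.restrict (Ici 0) s = 0 := by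
  rw [lineMeasure, withDensity_apply_eq_zero' hf.measurable.ennreal_ofReal.aemeasurable]
  have : {x | ENNReal.ofReal (f x) ≠ 0} = univ := by
    ext x; simpa using hf.pos x
  rw [this, univ_inter]

theorem IsWeight.lineMeasure_Ioo_pos (hf : IsWeight f) {a b : ℝ} (ha : 0 ≤ a) (hab : a < b) :
    0 < lineMeasure f (Ioo a b) := by
  rw [pos_iff_ne_zero, Ne, hf.lineMeasure_eq_zero_iff, Measure.restrict_apply measurableSet_Ioo,
    inter_eq_left.2 fun t ht => mem_Ici.2 (ha.trans ht.1.le)]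
  simpa using hab

theorem IsWeight.lineMeasure_Icc (hf : IsWeight f) (t : ℝ) :
    lineMeasure f (Icc 0 t) = ENNReal.ofReal (arc f t) :=
  (ENNReal.ofReal_toReal (hf.lineMeasure_Icc_lt_top t).ne).symm

theorem IsWeight.lineMeasure_Ioc (hf : IsWeight f) {a b : ℝ} (ha : 0 ≤ a) (hab : a ≤ b) :
    lineMeasure f (Ioc a b) = ENNReal.ofReal (arc f b - arc f a) := by
  have h : Ioc a b = Icc 0 b \ Icc 0 a := by
    ext t; simp only [mem_Ioc, mem_sdiff, mem_Icc, not_and, not_le]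
    exact ⟨fun h => ⟨⟨(ha.trans_lt h.1).le, h.2⟩, fun _ => h.1⟩, fun h => ⟨h.2 h.1.1, h.1.2⟩⟩
  rw [h, measure_sdiff (Icc_subset_Icc_right hab) measurableSet_Icc.nullMeasurableSet
    (hf.lineMeasure_Icc_lt_top a).ne, hf.lineMeasure_Icc, hf.lineMeasure_Icc,
    ENNReal.ofReal_sub _ (arc_nonneg f a)]

theorem IsWeight.arc_strictMonoOn (hf : IsWeight f) : StrictMonoOn (arc f) (Ici 0) := by
  intro a ha b _ hab
  have h := hf.lineMeasure_Ioc ha hab.le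
  have h2 := (hf.lineMeasure_Ioo_pos ha hab).trans_le (measure_mono Ioo_subset_Ioc_self)
  rw [h, ENNReal.ofReal_pos] at h2
  linarith

theorem IsWeight.arc_continuousOn (hf : IsWeight f) : ContinuousOn (arc f) (Ici 0) := by
  have h : ∀ a b, IntervalIntegrable ((Ici 0).indicator f) volume a b := by
    intro a b
    have h1 : IntegrableOn ((Ici 0).indicator f) (Icc (min a b) (max a b)) := by
      rw [IntegrableOn, integrable_indicator_iff measurableSet_Ici, IntegrableOn,
        Measure.restrict_restrict measurableSet_Ici]
      refine (hf.locallyIntegrableOn.integrableOn_compact_subset (t := Icc 0 (max a b))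
        Icc_subset_Ici_self isCompact_Icc).mono_set ?_
      exact fun t ht => ⟨ht.1, ht.2.2⟩
    exact ⟨h1.mono_set fun t ht => ⟨(min_le_left _ _).trans ht.1.le, ht.2.trans (le_max_right _ _)⟩,
      h1.mono_set fun t ht => ⟨(min_le_right _ _).trans ht.1.le, ht.2.trans (le_max_left _ _)⟩⟩
  refine (intervalIntegral.continuous_primitive h 0).continuousOn.congr fun t ht => ?_
  have ht : 0 ≤ t := ht
  dsimp only
  rw [intervalIntegral.integral_of_le ht, integral_eq_lintegral_of_nonneg_ae
    (Filter.Eventually.of_forall fun s => indicator_nonneg (fun s _ => (hf.pos s).le) s)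
    (hf.measurable.indicator measurableSet_Ici).aestronglyMeasurable, arc,
    ← Measure.restrict_apply_univ,
    lineMeasure_restrict_of_subset measurableSet_Icc Icc_subset_Ici_self,
    withDensity_apply _ MeasurableSet.univ, Measure.restrict_univ,
    setLIntegral_congr Ioc_ae_eq_Icc.symm]
  congr 1
  refine setLIntegral_congr_fun measurableSet_Ioc fun s hs => ?_
  rw [indicator_of_mem (show s ∈ Ici (0 : ℝ) from hs.1.le)]

/-! ### Order, geodesics and distance -/

theorem root_le (x : RegularTree K) : root K ≤ x := ⟨x.height_nonneg, List.nil_prefix⟩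

theorem le_of_le_of_height_le {a b z : RegularTree K} (ha : a ≤ z) (hb : b ≤ z)
    (h : a.height ≤ b.height) : a ≤ b := by
  refine ⟨h, List.prefix_of_prefix_length_le ha.2 hb.2 ?_⟩
  rw [a.length_vertex, b.length_vertex]
  exact Nat.ceil_mono h

theorem le_total_of_le {a b z : RegularTree K} (ha : a ≤ z) (hb : b ≤ z) : a ≤ b ∨ b ≤ a :=
  (le_total a.height b.height).imp (le_of_le_of_height_le ha hb) (le_of_le_of_height_le hb ha)

theorem IsWeight.radialMeasure_Iic (hf : IsWeight f) (y : RegularTree K) :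
    radialMeasure K f (Iic y) = ENNReal.ofReal (arc f y.height) := by
  have := setLIntegral_Iic hf.measurable (measurable_const (a := (1 : ℝ≥0∞))) y
  rw [setLIntegral_one, setLIntegral_one] at this
  rw [this, hf.lineMeasure_Icc]

/-- The point lies in the part of `Iic a` at the height of a, and that part corresponds to a null
set of the half-line. -/
theorem radialMeasure_singleton (hf : Measurable f) (a : RegularTree K) :
    radialMeasure K f {a} = 0 := by
  have h1 : Measurable (indicator {a.height} (fun _ => (1 : ℝ≥0∞))) :=
    measurable_const.indicator (measurableSet_singleton _)
  have h := setLIntegral_Iic hf h1 a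
  have h2 : ∫⁻ t in Icc 0 a.height, indicator {a.height} (fun _ => (1 : ℝ≥0∞)) t
      ∂(lineMeasure f) = 0 := by
    rw [lintegral_indicator (measurableSet_singleton _), setLIntegral_one]
    exact le_antisymm ((Measure.restrict_apply_le _ _).trans (measure_singleton _).le) zero_le
  rw [h2] at h
  have h3 : {a} ⊆ Iic a ∩ {w : RegularTree K | w.height = a.height} := by
    rintro _ rfl; exact ⟨mem_Iic.2 le_rfl, rfl⟩
  refine le_antisymm ((measure_mono h3).trans ?_) zero_le
  have hm : MeasurableSet {w : RegularTree K | w.height = a.height} :=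
    measurable_height (measurableSet_singleton a.height)
  rw [← h, inter_comm, ← Measure.restrict_apply hm, ← setLIntegral_one, ← lintegral_indicator hm]
  exact le_of_eq rfl

theorem radialMeasure_subsingleton (hf : Measurable f) {s : Set (RegularTree K)}
    (hs : s.Subsingleton) : radialMeasure K f s = 0 := by
  rcases hs.eq_empty_or_singleton with rfl | ⟨a, rfl⟩
  · simp
  · exact radialMeasure_singleton hf a

theorem symmDiff_subset_geodesic (z y : RegularTree K) :
    symmDiff (Iic z) (Iic y) ⊆ geodesic z y := by
  rintro w (⟨h1, h2⟩ | ⟨h1, h2⟩)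
  · refine ⟨Or.inl h1, fun a haz hay => (le_total_of_le haz h1).resolve_right fun h => ?_⟩
    exact h2 (h.trans hay)
  · refine ⟨Or.inr h1, fun a haz hay => (le_total_of_le hay h1).resolve_right fun h => ?_⟩
    exact h2 (h.trans haz)

theorem subsingleton_geodesic_diff (z y : RegularTree K) :
    (geodesic z y \ symmDiff (Iic z) (Iic y)).Subsingleton := by
  have key : ∀ w ∈ geodesic z y \ symmDiff (Iic z) (Iic y), w ≤ z ∧ w ≤ y := by
    rintro w ⟨hw, h⟩
    rcases hw.1 with h1 | h1
    · by_contra h2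
      exact h (Or.inl ⟨h1, fun h3 => h2 ⟨h1, h3⟩⟩)
    · by_contra h2
      exact h (Or.inr ⟨h1, fun h3 => h2 ⟨h3, h1⟩⟩)
  intro a ha b hb
  exact le_antisymm (hb.1.2 a (key a ha).1 (key a ha).2) (ha.1.2 b (key b hb).1 (key b hb).2)

/-- The two sets differ at most in the branch point of z and y. In the form of a symmetric
difference, the triangle inequality for the distance is the one for symmetric differences of sets,
and finiteness and measurability become accessible. -/
theorem geodesic_ae_eq (hf : Measurable f) (z y : RegularTree K) :
    geodesic z y =ᵐ[radialMeasure K f] (symmDiff (Iic z) (Iic y) : Set (RegularTree K)) := by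
  refine Filter.EventuallyLE.antisymm ?_ (symmDiff_subset_geodesic z y).eventuallyLE
  rw [ae_le_set]
  exact radialMeasure_subsingleton hf (subsingleton_geodesic_diff z y)

theorem geodesic_of_le {z y : RegularTree K} (h : z ≤ y) : geodesic z y = Icc z y := by
  ext w
  constructor
  · rintro ⟨h1, h2⟩
    exact ⟨h2 z le_rfl h, h1.elim (fun h3 => h3.trans h) id⟩
  · rintro ⟨h1, h2⟩
    exact ⟨Or.inr h2, fun a ha _ => ha.trans h1⟩

theorem geodesic_comm (z y : RegularTree K) : geodesic z y = geodesic y z := by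
  ext w
  constructor
  · rintro ⟨h1, h2⟩
    exact ⟨h1.symm, fun a h3 h4 => h2 a h4 h3⟩
  · rintro ⟨h1, h2⟩
    exact ⟨h1.symm, fun a h3 h4 => h2 a h4 h3⟩

theorem treeDist_comm (z y : RegularTree K) : treeDist f z y = treeDist f y z := by
  rw [treeDist, treeDist, geodesic_comm]

theorem treeDist_eq (hf : Measurable f) (z y : RegularTree K) :
    treeDist f z y = (radialMeasure K f (symmDiff (Iic z) (Iic y))).toReal := by
  rw [treeDist, measure_congr (geodesic_ae_eq hf z y)]

theorem IsWeight.radialMeasure_symmDiff_lt_top (hf : IsWeight f) (z y : RegularTree K) :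
    radialMeasure K f (symmDiff (Iic z) (Iic y)) < ∞ := by
  refine (measure_mono symmDiff_le_sup).trans_lt ((measure_union_le _ _).trans_lt ?_)
  rw [hf.radialMeasure_Iic, hf.radialMeasure_Iic]
  exact ENNReal.add_lt_top.2 ⟨ENNReal.ofReal_lt_top, ENNReal.ofReal_lt_top⟩

theorem IsWeight.treeDist_triangle (hf : IsWeight f) (x y z : RegularTree K) :
    treeDist f x z ≤ treeDist f x y + treeDist f y z := by
  simp only [treeDist_eq hf.measurable]
  rw [← ENNReal.toReal_add (hf.radialMeasure_symmDiff_lt_top _ _).ne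
    (hf.radialMeasure_symmDiff_lt_top _ _).ne]
  refine ENNReal.toReal_mono (ENNReal.add_lt_top.2 ⟨hf.radialMeasure_symmDiff_lt_top _ _,
    hf.radialMeasure_symmDiff_lt_top _ _⟩).ne ?_
  exact (measure_mono (symmDiff_triangle _ _ _)).trans (measure_union_le _ _)

theorem IsWeight.treeDist_of_le (hf : IsWeight f) {x y : RegularTree K} (h : x ≤ y) :
    treeDist f x y = arc f y.height - arc f x.height := by
  have h1 : symmDiff (Iic x) (Iic y) = Iic y \ Iic x := symmDiff_of_le (Iic_subset_Iic.2 h)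
  have h2 := hf.arc_strictMonoOn.monotoneOn x.height_nonneg y.height_nonneg h.1
  rw [treeDist_eq hf.measurable, h1, measure_sdiff (Iic_subset_Iic.2 h)
    (measurableSet_Iic_tree x).nullMeasurableSet (by rw [hf.radialMeasure_Iic]; simp),
    hf.radialMeasure_Iic, hf.radialMeasure_Iic, ← ENNReal.ofReal_sub _ (arc_nonneg _ _),
    ENNReal.toReal_ofReal (by linarith)]

theorem IsWeight.treeDist_root (hf : IsWeight f) (x : RegularTree K) :
    treeDist f (root K) x = arc f x.height := by
  rw [hf.treeDist_of_le (root_le x), show (root K).height = 0 from rfl, arc_zero, sub_zero]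

/-- The distance from x to y is the measure of a section of one measurable subset of the product,
hence measurable in y. -/
theorem IsWeight.measurableSet_treeBall (hf : IsWeight f) (x : RegularTree K) (r : ℝ) :
    MeasurableSet (treeBall f x r) := by
  have hm : MeasurableSet {q : RegularTree K × RegularTree K | q.2 ∈ symmDiff (Iic x) (Iic q.1)} := by
    have h1 : MeasurableSet {q : RegularTree K × RegularTree K | q.2 ≤ x} :=
      (measurableSet_Iic_tree x).preimage measurable_snd
    have h2 : MeasurableSet {q : RegularTree K × RegularTree K | q.2 ≤ q.1} :=
      measurableSet_le_pair.preimage measurable_swap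
    exact h1.symmDiff h2
  have h := (measurable_measure_prodMk_left (ν := radialMeasure K f) hm).ennreal_toReal
  have : treeBall f x r = {y | (radialMeasure K f (symmDiff (Iic x) (Iic y))).toReal < r} := by
    ext y; simp only [treeBall, treeDist_eq hf.measurable]
  rw [this]
  exact measurableSet_lt h measurable_const

/-! ### Half balls and points at prescribed distance -/

theorem IsWeight.mem_halfBall (hf : IsWeight f) {x y : RegularTree K} {r : ℝ} :
    y ∈ halfBall f x r ↔ x ≤ y ∧ arc f y.height < arc f x.height + r := by
  constructor
  · rintro ⟨h1, h2⟩
    rw [hf.treeDist_of_le h1] at h2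
    exact ⟨h1, by linarith⟩
  · rintro ⟨h1, h2⟩
    exact ⟨h1, by rw [hf.treeDist_of_le h1]; linarith⟩

theorem IsWeight.measurableSet_halfBall (hf : IsWeight f) (x : RegularTree K) (r : ℝ) :
    MeasurableSet (halfBall f x r) :=
  (measurableSet_Ici_tree x).inter (hf.measurableSet_treeBall x r)

theorem halfBall_subset_treeBall (x : RegularTree K) (r : ℝ) :
    halfBall f x r ⊆ treeBall f x r := fun _ h => h.2

/-- A bound on distances to the root would bound the diameter by twice as much, so the primitive is
unbounded; the intermediate value theorem does the rest. -/
theorem IsWeight.exists_arc_eq (hf : IsWeight f) (hd : InfiniteDiameter K f) {s : ℝ} (hs : 0 ≤ s) :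
    ∃ t, 0 ≤ t ∧ arc f t = s := by
  have h1 : ∃ b, 0 ≤ b ∧ s ≤ arc f b := by
    by_contra! h
    refine hd ⟨s + s, ?_⟩
    rintro _ ⟨q, rfl⟩
    refine (hf.treeDist_triangle q.1 (root K) q.2).trans ?_
    rw [treeDist_comm q.1, hf.treeDist_root, hf.treeDist_root]
    exact add_le_add (h _ q.1.height_nonneg).le (h _ q.2.height_nonneg).le
  obtain ⟨b, hb, hsb⟩ := h1
  obtain ⟨t, ht, hts⟩ := intermediate_value_Icc hb
    (hf.arc_continuousOn.mono Icc_subset_Ici_self) ⟨by rw [arc_zero]; exact hs, hsb⟩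
  exact ⟨t, ht.1, hts⟩

theorem IsWeight.arc_lt_iff (hf : IsWeight f) {a b : ℝ} (ha : 0 ≤ a) (hb : 0 ≤ b) :
    arc f a < arc f b ↔ a < b := hf.arc_strictMonoOn.lt_iff_lt ha hb

theorem IsWeight.arc_le_iff (hf : IsWeight f) {a b : ℝ} (ha : 0 ≤ a) (hb : 0 ≤ b) :
    arc f a ≤ arc f b ↔ a ≤ b := hf.arc_strictMonoOn.le_iff_le ha hb

theorem exists_le_height_eq (x : RegularTree K) {t : ℝ} (ht : 0 ≤ t) (htx : t ≤ x.height) :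
    ∃ a, a ≤ x ∧ a.height = t :=
  ⟨⟨x.vertex.take ⌈t⌉₊, t, ht, by
    rw [List.length_take, x.length_vertex]; exact min_eq_left (Nat.ceil_mono htx)⟩,
    ⟨htx, List.take_prefix _ _⟩, rfl⟩

theorem exists_height_eq_of_prefix (hK : 0 < K) (v : TreeVertex K) {t : ℝ} (ht : 0 ≤ t)
    (hv : v.length ≤ ⌈t⌉₊) : ∃ y : RegularTree K, v <+: y.vertex ∧ y.height = t :=
  ⟨⟨v ++ List.replicate (⌈t⌉₊ - v.length) ⟨0, hK⟩, t, ht, by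
    rw [List.length_append, List.length_replicate]; omega⟩, List.prefix_append _ _, rfl⟩

theorem IsWeight.exists_le_arc_eq (hf : IsWeight f) (hd : InfiniteDiameter K f)
    (x : RegularTree K) {s : ℝ} (hs : 0 ≤ s) (hsx : s ≤ arc f x.height) :
    ∃ a, a ≤ x ∧ arc f a.height = s := by
  obtain ⟨t, ht, rfl⟩ := hf.exists_arc_eq hd hs
  obtain ⟨a, ha, rfl⟩ := exists_le_height_eq x ht
    ((hf.arc_le_iff ht x.height_nonneg).1 hsx)
  exact ⟨a, ha, rfl⟩

theorem IsWeight.exists_ge_arc_eq (hK : 0 < K) (hf : IsWeight f) (hd : InfiniteDiameter K f)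
    (x : RegularTree K) {s : ℝ} (hsx : arc f x.height ≤ s) :
    ∃ y, x ≤ y ∧ arc f y.height = s := by
  obtain ⟨t, ht, rfl⟩ := hf.exists_arc_eq hd ((arc_nonneg f _).trans hsx)
  have htx := (hf.arc_le_iff x.height_nonneg ht).1 hsx
  obtain ⟨y, hy, rfl⟩ := exists_height_eq_of_prefix hK x.vertex ht
    (by rw [x.length_vertex]; exact Nat.ceil_mono htx)
  exact ⟨y, ⟨htx, hy⟩, rfl⟩

theorem IsWeight.upPoint_spec (hf : IsWeight f) (hd : InfiniteDiameter K f) (x : RegularTree K)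
    {r : ℝ} (hr : 0 ≤ r) :
    upPoint f x r ≤ x ∧ arc f (upPoint f x r).height = arc f x.height - min r (arc f x.height) := by
  have h : ∃ a, a ≤ x ∧ treeDist f a x = min r (treeDist f (root K) x) := by
    obtain ⟨a, ha, has⟩ := hf.exists_le_arc_eq hd x (s := arc f x.height - min r (arc f x.height))
      (sub_nonneg.2 (min_le_right _ _)) (by
        have := le_min hr (arc_nonneg f x.height); linarith)
    refine ⟨a, ha, ?_⟩
    rw [hf.treeDist_of_le ha, hf.treeDist_root, has]; ring
  obtain ⟨h1, h2⟩ : upPoint f x r ≤ x ∧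
      treeDist f (upPoint f x r) x = min r (treeDist f (root K) x) := Classical.epsilon_spec h
  refine ⟨h1, ?_⟩
  rw [hf.treeDist_of_le h1, hf.treeDist_root] at h2
  linarith

theorem IsWeight.downPoint_spec (hK : 0 < K) (hf : IsWeight f) (hd : InfiniteDiameter K f)
    (x : RegularTree K) {r : ℝ} (hr : 0 ≤ r) :
    x ≤ downPoint f x r ∧ arc f (downPoint f x r).height = arc f x.height + r := by
  have h : ∃ y, x ≤ y ∧ treeDist f x y = r := by
    obtain ⟨y, hy, hys⟩ := hf.exists_ge_arc_eq hK hd x (s := arc f x.height + r) (by linarith)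
    exact ⟨y, hy, by rw [hf.treeDist_of_le hy, hys]; ring⟩
  obtain ⟨h1, h2⟩ : x ≤ downPoint f x r ∧ treeDist f x (downPoint f x r) = r :=
    Classical.epsilon_spec h
  refine ⟨h1, ?_⟩
  rw [hf.treeDist_of_le h1] at h2
  linarith

/-- A path from x to a point that is not below c = x̄^r must run through all of [c,x], which has
length r unless c is the root. -/
theorem IsWeight.upPoint_le_of_mem_treeBall (hf : IsWeight f) (hd : InfiniteDiameter K f)
    {x y : RegularTree K} {r : ℝ} (hr : 0 < r) (hy : y ∈ treeBall f x r) :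
    upPoint f x r ≤ y := by
  obtain ⟨h1, h2⟩ := hf.upPoint_spec hd x hr.le
  set c := upPoint f x r
  by_contra hc
  rcases le_total r (arc f x.height) with hrx | hrx
  · rw [min_eq_left hrx] at h2
    have hsub : symmDiff (Iic c) (Iic x) ⊆ symmDiff (Iic x) (Iic y) := by
      rw [symmDiff_of_le (a := Iic c) (Iic_subset_Iic.2 h1)]
      rintro w ⟨hwx, hwc⟩
      refine Or.inl ⟨hwx, fun hwy => hc ?_⟩
      exact ((le_total_of_le h1 hwx).resolve_right hwc).trans hwy
    have h3 := ENNReal.toReal_mono (hf.radialMeasure_symmDiff_lt_top x y).ne (measure_mono hsub)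
    rw [← treeDist_eq hf.measurable, ← treeDist_eq hf.measurable, hf.treeDist_of_le h1] at h3
    have : treeDist f x y < r := hy
    linarith
  · rw [min_eq_right hrx, sub_self, ← arc_zero f] at h2
    have h3 := hf.arc_strictMonoOn.injOn c.height_nonneg (le_refl (0 : ℝ)) h2
    refine hc ⟨by rw [h3]; exact y.height_nonneg, ?_⟩
    have h4 := c.length_vertex
    rw [h3, Nat.ceil_zero, List.length_eq_zero_iff] at h4
    rw [h4]; exact List.nil_prefix

theorem IsWeight.treeBall_subset_halfBall (hf : IsWeight f) (hd : InfiniteDiameter K f)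
    (x : RegularTree K) {r : ℝ} (hr : 0 < r) :
    treeBall f x r ⊆ halfBall f (upPoint f x r) (2 * r) := by
  intro y hy
  obtain ⟨h1, h2⟩ := hf.upPoint_spec hd x hr.le
  have h3 := hf.upPoint_le_of_mem_treeBall hd hr hy
  refine ⟨h3, ?_⟩
  have h4 := hf.treeDist_triangle (upPoint f x r) x y
  rw [hf.treeDist_of_le h1] at h4
  have h5 : treeDist f x y < r := hy
  have h6 := min_le_left r (arc f x.height)
  linarith

theorem IsWeight.treeBall_subset_treeBall (hf : IsWeight f) {x y : RegularTree K} {r s : ℝ}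
    (h : treeDist f y x + r ≤ s) : treeBall f x r ⊆ treeBall f y s := by
  intro z hz
  have h1 : treeDist f x z < r := hz
  have h2 := hf.treeDist_triangle y x z
  exact show treeDist f y z < s by linarith

/-! ### Integration over half balls and the two factors of A_p -/

/-- The reciprocal of the number of points at the height of `w` which lie below `x`. -/
def branchWeight (x w : RegularTree K) : ℝ≥0∞ :=
  ((K : ℝ≥0∞) ^ (w.generation - x.generation))⁻¹

theorem measurable_branchWeight (x : RegularTree K) : Measurable (branchWeight x) :=
  (measurable_from_top (f := fun n : ℕ => ((K : ℝ≥0∞) ^ (n - x.generation))⁻¹)).comp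
    measurable_generation

theorem natCast_pow_ne_zero (hK : 0 < K) (n : ℕ) : (K : ℝ≥0∞) ^ n ≠ 0 :=
  pow_ne_zero _ (by exact_mod_cast hK.ne')

theorem natCast_pow_ne_top (n : ℕ) : (K : ℝ≥0∞) ^ n ≠ ∞ :=
  ENNReal.pow_ne_top (ENNReal.natCast_ne_top K)

theorem IsWeight.setLIntegral_halfBall (hl : IsWeight lam) (hf : Measurable f) {φ : ℝ → ℝ≥0∞}
    (hφ : Measurable φ) (x : RegularTree K) {r h : ℝ} (h0 : 0 ≤ h)
    (hh : arc lam h = arc lam x.height + r) :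
    ∫⁻ w in halfBall lam x r, φ w.height ∂(radialMeasure K f) =
      ∫⁻ t in Ico x.height h, (K : ℝ≥0∞) ^ (⌈t⌉₊ - x.generation) * φ t ∂(lineMeasure f) := by
  have e : halfBall lam x r = Ici x ∩ {w | w.height < h} := by
    ext w
    rw [hl.mem_halfBall, ← hh, hl.arc_lt_iff w.height_nonneg h0]
    rfl
  have hm : MeasurableSet {w : RegularTree K | w.height < h} :=
    measurableSet_lt measurable_height measurable_const
  have key := setLIntegral_Ici (K := K) hf (hφ.indicator (measurableSet_Iio (a := h))) x
  rw [e, inter_comm, ← Measure.restrict_restrict hm, ← lintegral_indicator hm]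
  refine Eq.trans ?_ (key.trans ?_)
  · rfl
  · rw [← Ici_inter_Iio, inter_comm, ← Measure.restrict_restrict measurableSet_Iio,
      ← lintegral_indicator measurableSet_Iio]
    refine lintegral_congr fun t => ?_
    by_cases ht : t ∈ Iio h
    · rw [indicator_of_mem ht, indicator_of_mem ht]
    · rw [indicator_of_notMem ht, indicator_of_notMem ht, mul_zero]

/-- The weight cancels the number of points at each height, so a weighted radial integral over
F(x,r) equals the integral along one geodesic below x. -/
theorem IsWeight.setLIntegral_halfBall_branchWeight (hK : 0 < K) (hl : IsWeight lam)
    (hf : Measurable f) {φ : ℝ → ℝ≥0∞} (hφ : Measurable φ) (x : RegularTree K) {r h : ℝ}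
    (h0 : 0 ≤ h) (hh : arc lam h = arc lam x.height + r) :
    ∫⁻ w in halfBall lam x r, branchWeight x w * φ w.height ∂(radialMeasure K f) =
      ∫⁻ t in Ico x.height h, φ t ∂(lineMeasure f) := by
  have hm : Measurable fun t : ℝ => ((K : ℝ≥0∞) ^ (⌈t⌉₊ - x.generation))⁻¹ * φ t :=
    ((measurable_from_top (f := fun n : ℕ => ((K : ℝ≥0∞) ^ (n - x.generation))⁻¹)).comp
      Nat.measurable_ceil).mul hφ
  refine (hl.setLIntegral_halfBall hf hm x h0 hh).trans (lintegral_congr fun t => ?_)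
  rw [← mul_assoc, ENNReal.mul_inv_cancel (natCast_pow_ne_zero hK _) (natCast_pow_ne_top _),
    one_mul]

theorem setLIntegral_geodesic (hf : Measurable f) {φ : ℝ → ℝ≥0∞} (hφ : Measurable φ)
    {x y : RegularTree K} (hxy : x ≤ y) :
    ∫⁻ w in geodesic x y, φ w.height ∂(radialMeasure K f) =
      ∫⁻ t in Icc x.height y.height, φ t ∂(lineMeasure f) := by
  have e : geodesic x y = {w | x.height ≤ w.height} ∩ Iic y := by
    rw [geodesic_of_le hxy]
    ext w
    exact ⟨fun h => ⟨h.1.1, h.2⟩, fun h => ⟨le_of_le_of_height_le hxy h.2 h.1, h.2⟩⟩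
  have hm : MeasurableSet {w : RegularTree K | x.height ≤ w.height} :=
    measurableSet_le measurable_const measurable_height
  have key := setLIntegral_Iic (K := K) hf (hφ.indicator (measurableSet_Ici (a := x.height))) y
  have e2 : Icc x.height y.height = Ici x.height ∩ Icc 0 y.height := by
    ext t
    exact ⟨fun h => ⟨h.1, x.height_nonneg.trans h.1, h.2⟩, fun h => ⟨h.1, h.2.2⟩⟩
  rw [e, ← Measure.restrict_restrict hm, ← lintegral_indicator hm, e2,
    ← Measure.restrict_restrict measurableSet_Ici, ← lintegral_indicator measurableSet_Ici, ← key]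
  rfl

/-- As an identity of measures, this also transports essential suprema, which the case p = 1
requires. -/
theorem map_height_restrict_geodesic (hf : Measurable f) {x y : RegularTree K} (hxy : x ≤ y) :
    Measure.map height ((radialMeasure K f).restrict (geodesic x y)) =
      (lineMeasure f).restrict (Icc x.height y.height) := by
  ext A hA
  have h := setLIntegral_geodesic hf (measurable_const.indicator hA (f := fun _ => (1 : ℝ≥0∞))) hxy
  rw [lintegral_indicator hA, setLIntegral_one] at h
  rw [Measure.map_apply measurable_height hA, ← h, ← setLIntegral_one,
    ← lintegral_indicator (measurable_height hA)]
  rfl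

/-- The density `K ^ (⌈t⌉ - j(x)) μ(t) / λ(t)` as a function of the height `t`. -/
def heightDensity (lam mu : ℝ → ℝ) (x : RegularTree K) (t : ℝ) : ℝ :=
  (K : ℝ) ^ ((⌈t⌉₊ : ℤ) - (x.generation : ℤ)) * mu t / lam t

theorem measurable_heightDensity (hl : Measurable lam) (hm : Measurable mu) (x : RegularTree K) :
    Measurable (heightDensity lam mu x) :=
  (((measurable_from_top (f := fun n : ℕ => (K : ℝ) ^ ((n : ℤ) - (x.generation : ℤ)))).comp
    Nat.measurable_ceil).mul hm).div hl

theorem heightDensity_pos (hK : 0 < K) (hl : ∀ t, 0 < lam t) (hm : ∀ t, 0 < mu t)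
    (x : RegularTree K) (t : ℝ) : 0 < heightDensity lam mu x t := by
  have : (0 : ℝ) < K := by exact_mod_cast hK
  exact div_pos (mul_pos (zpow_pos this _) (hm t)) (hl t)

theorem ofReal_heightDensity (x : RegularTree K) {t : ℝ} (ht : x.height ≤ t) :
    ENNReal.ofReal (heightDensity lam mu x t) =
      (K : ℝ≥0∞) ^ (⌈t⌉₊ - x.generation) * ENNReal.ofReal (mu t / lam t) := by
  have hg : x.generation ≤ ⌈t⌉₊ := Nat.ceil_mono ht
  have h1 : ((⌈t⌉₊ : ℤ) - (x.generation : ℤ)) = ((⌈t⌉₊ - x.generation : ℕ) : ℤ) := by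
    rw [Nat.cast_sub hg]
  rw [heightDensity, h1, zpow_natCast, mul_div_assoc, ENNReal.ofReal_mul (by positivity),
    ENNReal.ofReal_pow (by positivity), ENNReal.ofReal_natCast]

/-- Change of density from μ to λ on the half-line, with the number of branches absorbed into
`heightDensity`. -/
theorem setLIntegral_lineMeasure_heightDensity (hl : IsWeight lam)
    (hm : IsWeight mu) (x : RegularTree K) {φ : ℝ → ℝ≥0∞} (hφ : Measurable φ) {s : Set ℝ}
    (hs : MeasurableSet s) (hsx : s ⊆ Ici x.height) :
    ∫⁻ t in s, (K : ℝ≥0∞) ^ (⌈t⌉₊ - x.generation) * φ t ∂(lineMeasure mu) =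
      ∫⁻ t in s, φ t * ENNReal.ofReal (heightDensity lam mu x t) ∂(lineMeasure lam) := by
  have hs0 : s ⊆ Ici 0 := fun t ht => mem_Ici.2 (x.height_nonneg.trans (hsx ht))
  have hk : Measurable fun t : ℝ => (K : ℝ≥0∞) ^ (⌈t⌉₊ - x.generation) :=
    (measurable_from_top (f := fun n : ℕ => (K : ℝ≥0∞) ^ (n - x.generation))).comp
      Nat.measurable_ceil
  rw [lineMeasure_restrict_of_subset hs hs0, lineMeasure_restrict_of_subset hs hs0]
  refine (lintegral_withDensity_eq_lintegral_mul _ hm.measurable.ennreal_ofReal (hk.mul hφ)).trans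
    (Eq.trans ?_ (lintegral_withDensity_eq_lintegral_mul _ hl.measurable.ennreal_ofReal
      (hφ.mul (measurable_heightDensity hl.measurable hm.measurable x).ennreal_ofReal)).symm)
  refine setLIntegral_congr_fun hs fun t ht => ?_
  have h1 := ofReal_heightDensity (lam := lam) (mu := mu) x (hsx ht)
  have h2 : ENNReal.ofReal (mu t) = ENNReal.ofReal (mu t / lam t) * ENNReal.ofReal (lam t) := by
    rw [← ENNReal.ofReal_mul (div_pos (hm.pos t) (hl.pos t)).le, div_mul_cancel₀ _ (hl.pos t).ne']
  simp only [Pi.mul_apply]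
  rw [h1, h2]
  ring

theorem lintegral_radialMeasure_mul_div (hl : IsWeight lam) (hm : IsWeight mu)
    {G : RegularTree K → ℝ≥0∞} (hG : Measurable G) {s : Set (RegularTree K)}
    (hs : MeasurableSet s) :
    ∫⁻ w in s, G w ∂(radialMeasure K mu) =
      ∫⁻ w in s, G w * ENNReal.ofReal (mu w.height / lam w.height) ∂(radialMeasure K lam) := by
  have hl' := hl.measurable.ennreal_ofReal.comp (measurable_height (K := K))
  have hm' := hm.measurable.ennreal_ofReal.comp (measurable_height (K := K))
  have hq : Measurable fun w : RegularTree K => ENNReal.ofReal (mu w.height / lam w.height) :=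
    (hm.measurable.div hl.measurable).ennreal_ofReal.comp measurable_height
  rw [radialMeasure, radialMeasure, restrict_withDensity hs, restrict_withDensity hs]
  refine (lintegral_withDensity_eq_lintegral_mul _ hm' hG).trans
    (Eq.trans ?_ (lintegral_withDensity_eq_lintegral_mul _ hl' (hG.mul hq)).symm)
  refine lintegral_congr fun w => ?_
  have h2 : ENNReal.ofReal (mu w.height) =
      ENNReal.ofReal (mu w.height / lam w.height) * ENNReal.ofReal (lam w.height) := by
    rw [← ENNReal.ofReal_mul (div_pos (hm.pos _) (hl.pos _)).le, div_mul_cancel₀ _ (hl.pos _).ne']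
  simp only [Pi.mul_apply, Function.comp]
  rw [h2]
  ring

/-- The factor of `apQuantity` which is dual to the weight, without the powers of the radius. -/
def dualFactor (lam mu : ℝ → ℝ) (p : ℝ) (x y : RegularTree K) : ℝ≥0∞ :=
  if p = 1 then
    essSup (fun t => ENNReal.ofReal (1 / heightDensity lam mu x t))
      ((lineMeasure lam).restrict (Icc x.height y.height))
  else
    (∫⁻ t in Icc x.height y.height, ENNReal.ofReal (heightDensity lam mu x t ^ (1 / (1 - p)))
      ∂(lineMeasure lam)) ^ (p - 1)

/-- The factors 1/(2r) and (1/r)^{p-1} combine to 1/(2r^p), so that p = 1 and p > 1 take the same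
form. -/
theorem apQuantity_eq (hl : IsWeight lam) (hm : IsWeight mu) {p : ℝ} (hp : 1 ≤ p)
    {x : RegularTree K} {r : ℝ} (hr : 0 < r) (hx : x ≤ downPoint lam x r) :
    apQuantity lam mu p x r =
      radialMeasure K mu (halfBall lam (upPoint lam x r) (2 * r)) *
        dualFactor lam mu p x (downPoint lam x r) / ENNReal.ofReal (2 * r ^ p) := by
  have hmeas := measurable_heightDensity hl.measurable hm.measurable x
  rw [apQuantity, dualFactor]
  split_ifs with h1
  · have hφ : Measurable fun t => ENNReal.ofReal (1 / heightDensity lam mu x t) :=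
      (measurable_const.div hmeas).ennreal_ofReal
    rw [← map_height_restrict_geodesic hl.measurable hx,
      essSup_map_measure hφ.aemeasurable measurable_height.aemeasurable, h1, Real.rpow_one,
      ENNReal.mul_div_right_comm]
    rfl
  · have hφ : Measurable fun t => ENNReal.ofReal (heightDensity lam mu x t ^ (1 / (1 - p))) :=
      (hmeas.pow_const _).ennreal_ofReal
    have e : ∫⁻ w in geodesic x (downPoint lam x r),
        ENNReal.ofReal (branchDensity lam mu x w ^ (1 / (1 - p))) ∂(radialMeasure K lam) =
        ∫⁻ t in Icc x.height (downPoint lam x r).height,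
          ENNReal.ofReal (heightDensity lam mu x t ^ (1 / (1 - p))) ∂(lineMeasure lam) :=
      setLIntegral_geodesic hl.measurable hφ hx
    have h2 : ENNReal.ofReal (1 / r) ^ (p - 1) = (ENNReal.ofReal (r ^ (p - 1)))⁻¹ := by
      rw [one_div, ENNReal.ofReal_inv_of_pos hr, ENNReal.inv_rpow,
        ENNReal.ofReal_rpow_of_pos hr]
    have h3 : ENNReal.ofReal (2 * r ^ p) = ENNReal.ofReal (2 * r) * ENNReal.ofReal (r ^ (p - 1)) := by
      rw [← ENNReal.ofReal_mul (by positivity), mul_assoc, ← Real.rpow_one_add' hr.le (by linarith)]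
      congr 3; ring
    rw [e, ENNReal.mul_rpow_of_nonneg _ _ (by linarith : (0 : ℝ) ≤ p - 1), h2, h3]
    generalize ∫⁻ t in Icc x.height (downPoint lam x r).height,
      ENNReal.ofReal (heightDensity lam mu x t ^ (1 / (1 - p))) ∂(lineMeasure lam) = I
    rw [div_eq_mul_inv, div_eq_mul_inv, ENNReal.mul_inv (Or.inl (by simpa using hr)) (Or.inl ENNReal.ofReal_ne_top)]
    ring

theorem IsWeight.measure_halfBall_eq (hl : IsWeight lam) (hm : IsWeight mu) (x : RegularTree K)
    {r h : ℝ} (h0 : 0 ≤ h) (hh : arc lam h = arc lam x.height + r) :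
    radialMeasure K mu (halfBall lam x r) =
      ∫⁻ t in Ico x.height h, (K : ℝ≥0∞) ^ (⌈t⌉₊ - x.generation) ∂(lineMeasure mu) := by
  have := hl.setLIntegral_halfBall hm.measurable (measurable_const (a := (1 : ℝ≥0∞))) x h0 hh
  simpa using this

theorem IsWeight.measure_halfBall_lt_top (hl : IsWeight lam) (hm : IsWeight mu)
    (hd : InfiniteDiameter K lam) (x : RegularTree K) {r : ℝ} (hr : 0 < r) :
    radialMeasure K mu (halfBall lam x r) < ∞ := by
  obtain ⟨h, h0, hh⟩ := hl.exists_arc_eq hd (s := arc lam x.height + r)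
    (add_nonneg (arc_nonneg _ _) hr.le)
  rw [hl.measure_halfBall_eq hm x h0 hh]
  -- The base K + 1 is at least 1 even for K = 0, so its powers are monotone in the exponent.
  have hb : ∀ t ∈ Ico x.height h, (K : ℝ≥0∞) ^ (⌈t⌉₊ - x.generation) ≤
      ((K + 1 : ℕ) : ℝ≥0∞) ^ ⌈h⌉₊ := by
    intro t ht
    calc (K : ℝ≥0∞) ^ (⌈t⌉₊ - x.generation) ≤ ((K + 1 : ℕ) : ℝ≥0∞) ^ (⌈t⌉₊ - x.generation) :=
          pow_le_pow_left' (by exact_mod_cast Nat.le_succ K) _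
      _ ≤ _ := pow_le_pow_right₀ (by exact_mod_cast Nat.succ_pos K)
          ((Nat.sub_le _ _).trans (Nat.ceil_mono ht.2.le))
  refine (setLIntegral_mono' measurableSet_Ico hb).trans_lt ?_
  rw [setLIntegral_const]
  refine ENNReal.mul_lt_top (lt_top_iff_ne_top.2 (natCast_pow_ne_top _))
    ((measure_mono ?_).trans_lt (hm.lineMeasure_Icc_lt_top h))
  exact fun t ht => ⟨x.height_nonneg.trans ht.1, ht.2.le⟩

theorem IsWeight.measure_halfBall_pos (hK : 0 < K) (hl : IsWeight lam) (hm : IsWeight mu)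
    (hd : InfiniteDiameter K lam) (x : RegularTree K) {r : ℝ} (hr : 0 < r) :
    0 < radialMeasure K mu (halfBall lam x r) := by
  obtain ⟨h, h0, hh⟩ := hl.exists_arc_eq hd (s := arc lam x.height + r)
    (add_nonneg (arc_nonneg _ _) hr.le)
  have hxh : x.height < h := (hl.arc_lt_iff x.height_nonneg h0).1 (by linarith)
  rw [hl.measure_halfBall_eq hm x h0 hh]
  have hb : ∀ t ∈ Ico x.height h, (1 : ℝ≥0∞) ≤ (K : ℝ≥0∞) ^ (⌈t⌉₊ - x.generation) :=
    fun t _ => one_le_pow₀ (by exact_mod_cast hK)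
  refine lt_of_lt_of_le ?_ (setLIntegral_mono' measurableSet_Ico hb)
  rw [setLIntegral_one]
  exact (hm.lineMeasure_Ioo_pos x.height_nonneg hxh).trans_le (measure_mono Ioo_subset_Ico_self)

theorem apQuantity_le_iff (hl : IsWeight lam) (hm : IsWeight mu)
    {p : ℝ} (hp : 1 ≤ p)
    {x : RegularTree K} {r : ℝ} (hr : 0 < r) (hx : x ≤ downPoint lam x r) {C : ℝ≥0∞} :
    apQuantity lam mu p x r ≤ C ↔
      radialMeasure K mu (halfBall lam (upPoint lam x r) (2 * r)) *
        dualFactor lam mu p x (downPoint lam x r) ≤ C * ENNReal.ofReal (2 * r ^ p) := by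
  have h : (0 : ℝ) < 2 * r ^ p := mul_pos two_pos (Real.rpow_pos_of_pos hr _)
  rw [apQuantity_eq hl hm hp hr hx,
    ENNReal.div_le_iff (by simpa using h) ENNReal.ofReal_ne_top]

/-! ### Duality between the Hardy inequality and the dual factor -/

/-- A weighted one-dimensional Hardy-type inequality for functions on a half ball. -/
def HardyBound (lam mu : ℝ → ℝ) (p : ℝ) (C : ℝ≥0∞) (x : RegularTree K) (r : ℝ) : Prop :=
  ∀ g : RegularTree K → ℝ≥0∞, Measurable g →
    (∫⁻ w in halfBall lam x r, branchWeight x w * g w ∂(radialMeasure K lam)) ^ p *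
        radialMeasure K mu (halfBall lam (upPoint lam x r) (2 * r)) ≤
      C * ENNReal.ofReal r ^ p * ∫⁻ w in halfBall lam x r, g w ^ p ∂(radialMeasure K mu)

theorem ennreal_rpow_eq_mul (a : ℝ≥0∞) {p : ℝ} (hp : 1 ≤ p) : a ^ p = a * a ^ (p - 1) := by
  conv_lhs => rw [show p = 1 + (p - 1) by ring]
  rw [ENNReal.rpow_add_of_nonneg _ _ zero_le_one (by linarith), ENNReal.rpow_one]

/-- Pointwise, K^{j(x)-j(w)} is the reciprocal of `heightDensity` times μ/λ, and the reciprocal is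
almost everywhere at most the essential supremum. -/
theorem setLIntegral_branchWeight_mul_le_of_one (hK : 0 < K) (hl : IsWeight lam)
    (hm : IsWeight mu) {x y : RegularTree K} {r : ℝ}
    (hy : arc lam y.height = arc lam x.height + r)
    {g : RegularTree K → ℝ≥0∞} (hg : Measurable g) :
    ∫⁻ w in halfBall lam x r, branchWeight x w * g w ∂(radialMeasure K lam) ≤
      dualFactor lam mu 1 x y * ∫⁻ w in halfBall lam x r, g w ∂(radialMeasure K mu) := by
  have hF := hl.measurableSet_halfBall x r
  have hmeas := measurable_heightDensity hl.measurable hm.measurable x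
  set J := dualFactor lam mu 1 x y with hJ
  rw [dualFactor, if_pos rfl] at hJ
  rw [lintegral_radialMeasure_mul_div hl hm hg hF]
  have hq : Measurable fun w : RegularTree K => ENNReal.ofReal (mu w.height / lam w.height) :=
    (hm.measurable.div hl.measurable).ennreal_ofReal.comp measurable_height
  have hgq : Measurable fun w => g w * ENNReal.ofReal (mu w.height / lam w.height) := hg.mul hq
  rw [← lintegral_const_mul _ hgq]
  let A : Set ℝ := {t | ¬ ENNReal.ofReal (1 / heightDensity lam mu x t) ≤ J}
  have hφ : Measurable fun t => ENNReal.ofReal (1 / heightDensity lam mu x t) :=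
    (measurable_const.div hmeas).ennreal_ofReal
  have hA : MeasurableSet A := (measurableSet_le hφ measurable_const).compl
  have hA0 : lineMeasure lam (A ∩ Icc x.height y.height) = 0 := by
    have := ae_le_essSup (μ := (lineMeasure lam).restrict (Icc x.height y.height))
      (f := fun t => ENNReal.ofReal (1 / heightDensity lam mu x t))
    rw [← hJ, ae_iff, Measure.restrict_apply hA] at this
    exact this
  -- The exceptional heights are null on the half-line; integrating their indicator over the half
  -- ball shows that they are null on the tree.
  have hae : ∀ᵐ w ∂((radialMeasure K lam).restrict (halfBall lam x r)), w.height ∉ A := by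
    have h1 := hl.setLIntegral_halfBall hl.measurable
      (measurable_const.indicator hA (f := fun _ => (1 : ℝ≥0∞))) x y.height_nonneg hy
    have h2 : ∫⁻ t in Ico x.height y.height, (K : ℝ≥0∞) ^ (⌈t⌉₊ - x.generation) *
        A.indicator (fun _ => (1 : ℝ≥0∞)) t ∂(lineMeasure lam) = 0 := by
      have : ∀ᵐ t ∂((lineMeasure lam).restrict (Ico x.height y.height)), t ∉ A := by
        have e : {t | ¬ t ∉ A} = A := by ext t; exact not_not
        rw [ae_iff, e, Measure.restrict_apply hA]
        exact measure_mono_null (inter_subset_inter_right _ Ico_subset_Icc_self) hA0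
      rw [← lintegral_zero (μ := (lineMeasure lam).restrict (Ico x.height y.height))]
      refine lintegral_congr_ae (this.mono fun t ht => ?_)
      dsimp only
      rw [indicator_of_notMem ht, mul_zero]
    have hAm : Measurable fun w : RegularTree K => A.indicator (fun _ => (1 : ℝ≥0∞)) w.height :=
      (measurable_const.indicator hA).comp measurable_height
    rw [h2, lintegral_eq_zero_iff hAm] at h1
    filter_upwards [h1] with w hw hwA
    simp [hwA] at hw
  refine lintegral_mono_ae ?_
  filter_upwards [hae, ae_restrict_mem hF] with w hwA hwF
  have h1 : ENNReal.ofReal (1 / heightDensity lam mu x w.height) ≤ J := not_not.1 hwA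
  have h3 := ofReal_heightDensity (lam := lam) (mu := mu) x hwF.1.1
  have hpos := heightDensity_pos hK hl.pos hm.pos x w.height
  have hW : ENNReal.ofReal (mu w.height / lam w.height) ≠ 0 := by
    simpa using div_pos (hm.pos _) (hl.pos _)
  have h4 : branchWeight x w = ENNReal.ofReal (1 / heightDensity lam mu x w.height) *
      ENNReal.ofReal (mu w.height / lam w.height) := by
    rw [one_div, ENNReal.ofReal_inv_of_pos hpos, h3,
      ENNReal.mul_inv (Or.inl (natCast_pow_ne_zero hK _)) (Or.inl (natCast_pow_ne_top _)),
      mul_assoc, ENNReal.inv_mul_cancel hW ENNReal.ofReal_ne_top, mul_one]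
    rfl
  rw [h4, mul_right_comm, mul_comm (g w), ← mul_assoc, mul_right_comm]
  gcongr

theorem setLIntegral_branchWeight_mul_rpow_le (hK : 0 < K) (hl : IsWeight lam) (hm : IsWeight mu)
    {p : ℝ} (hp : 1 < p) {x y : RegularTree K} {r : ℝ}
    (hy : arc lam y.height = arc lam x.height + r)
    {g : RegularTree K → ℝ≥0∞} (hg : Measurable g) :
    (∫⁻ w in halfBall lam x r, branchWeight x w * g w ∂(radialMeasure K lam)) ^ p ≤
      dualFactor lam mu p x y * ∫⁻ w in halfBall lam x r, g w ^ p ∂(radialMeasure K mu) := by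
  have hF := hl.measurableSet_halfBall x r
  have hp0 : 0 < p := by linarith
  have hp1 : 0 < p - 1 := by linarith
  have hmeas := measurable_heightDensity hl.measurable hm.measurable x
  have hφ : Measurable fun t => ENNReal.ofReal (heightDensity lam mu x t ^ (1 / (1 - p))) :=
    (hmeas.pow_const _).ennreal_ofReal
  have hq : Measurable fun w : RegularTree K => ENNReal.ofReal (mu w.height / lam w.height) :=
    (hm.measurable.div hl.measurable).ennreal_ofReal.comp measurable_height
  rw [dualFactor, if_neg hp.ne', setLIntegral_congr Ico_ae_eq_Icc.symm,
    ← hl.setLIntegral_halfBall_branchWeight hK hl.measurable hφ x y.height_nonneg hy,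
    lintegral_radialMeasure_mul_div hl hm (hg.pow_const p) hF]
  have hpq : p.HolderConjugate (p / (p - 1)) := Real.HolderConjugate.conjExponent hp
  let W : RegularTree K → ℝ≥0∞ := fun w => ENNReal.ofReal (mu w.height / lam w.height)
  have hW0 : ∀ w, W w ≠ 0 := fun w => by
    simpa [W] using div_pos (hm.pos _) (hl.pos _)
  have hWt : ∀ w, W w ≠ ∞ := fun w => ENNReal.ofReal_ne_top
  -- Hölder with W = μ/λ. If k is the number of branches and q = p/(p-1), then (k⁻¹ W^{-1/p})^q =
  -- k⁻¹ (kW)^{1/(1-p)}, so the second factor is again a weighted radial integral and equals the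
  -- dual factor.
  let a : RegularTree K → ℝ≥0∞ := fun w => g w * W w ^ (1 / p)
  let b : RegularTree K → ℝ≥0∞ := fun w => branchWeight x w * (W w ^ (1 / p))⁻¹
  have ha : Measurable a := hg.mul (hq.pow_const _)
  have hb : Measurable b := (measurable_branchWeight x).mul (hq.pow_const _).inv
  have h := ENNReal.lintegral_mul_le_Lp_mul_Lq ((radialMeasure K lam).restrict (halfBall lam x r))
    hpq ha.aemeasurable hb.aemeasurable
  have hab : ∀ w, (a * b) w = branchWeight x w * g w := by
    intro w
    have h0 : W w ^ (1 / p) ≠ 0 := by simp [ENNReal.rpow_eq_zero_iff, hW0 w, hWt w]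
    have h1 : W w ^ (1 / p) ≠ ∞ := ENNReal.rpow_ne_top_of_nonneg (by positivity) (hWt w)
    simp only [a, b, Pi.mul_apply]
    calc g w * W w ^ (1 / p) * (branchWeight x w * (W w ^ (1 / p))⁻¹)
        = branchWeight x w * g w * (W w ^ (1 / p) * (W w ^ (1 / p))⁻¹) := by ring
      _ = _ := by rw [ENNReal.mul_inv_cancel h0 h1, mul_one]
  have hap : ∀ w, a w ^ p = g w ^ p * W w := by
    intro w
    simp only [a]
    rw [ENNReal.mul_rpow_of_nonneg _ _ hp0.le, ← ENNReal.rpow_mul, one_div_mul_cancel hp0.ne',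
      ENNReal.rpow_one]
  have hbq : ∀ w ∈ halfBall lam x r, b w ^ (p / (p - 1)) = branchWeight x w *
      ENNReal.ofReal (heightDensity lam mu x w.height ^ (1 / (1 - p))) := by
    intro w hw
    have h3 := ofReal_heightDensity (lam := lam) (mu := mu) x hw.1.1
    have hpos := heightDensity_pos hK hl.pos hm.pos x w.height
    have hk0 := natCast_pow_ne_zero hK (w.generation - x.generation)
    have hkt := natCast_pow_ne_top (K := K) (w.generation - x.generation)
    rw [← ENNReal.ofReal_rpow_of_pos hpos, h3]
    change (((K : ℝ≥0∞) ^ (w.generation - x.generation))⁻¹ * (W w ^ (1 / p))⁻¹) ^ (p / (p - 1)) =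
      ((K : ℝ≥0∞) ^ (w.generation - x.generation))⁻¹ *
        ((K : ℝ≥0∞) ^ (w.generation - x.generation) * W w) ^ (1 / (1 - p))
    generalize (K : ℝ≥0∞) ^ (w.generation - x.generation) = k at hk0 hkt
    rw [ENNReal.mul_rpow_of_ne_top (ENNReal.inv_ne_top.2 hk0)
      (by rw [← ENNReal.rpow_neg]; exact ENNReal.rpow_ne_top_of_ne_zero (hW0 w) (hWt w)),
      ENNReal.mul_rpow_of_ne_top hkt (hWt w), ← ENNReal.rpow_neg, ← ENNReal.rpow_mul,
      ← mul_assoc, ← ENNReal.rpow_neg_one k, ← ENNReal.rpow_mul, ← ENNReal.rpow_add _ _ hk0 hkt]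
    have hne : 1 - p ≠ 0 := by linarith
    congr 2
    · field_simp; ring
    · field_simp; ring
  simp only [hab, hap] at h
  rw [setLIntegral_congr_fun hF hbq] at h
  have h5 := ENNReal.rpow_le_rpow h hp0.le
  rw [ENNReal.mul_rpow_of_nonneg _ _ hp0.le, ← ENNReal.rpow_mul, ← ENNReal.rpow_mul,
    one_div_mul_cancel hp0.ne', ENNReal.rpow_one, mul_comm] at h5
  have e : 1 / (p / (p - 1)) * p = p - 1 := by field_simp
  rwa [e] at h5

theorem setLIntegral_branchWeight_mul_rpow_le_dualFactor (hK : 0 < K) (hl : IsWeight lam)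
    (hm : IsWeight mu) {p : ℝ} (hp : 1 ≤ p) {x y : RegularTree K} {r : ℝ}
    (hy : arc lam y.height = arc lam x.height + r)
    {g : RegularTree K → ℝ≥0∞} (hg : Measurable g) :
    (∫⁻ w in halfBall lam x r, branchWeight x w * g w ∂(radialMeasure K lam)) ^ p ≤
      dualFactor lam mu p x y * ∫⁻ w in halfBall lam x r, g w ^ p ∂(radialMeasure K mu) := by
  rcases hp.eq_or_lt with rfl | hp
  · simpa only [ENNReal.rpow_one] using setLIntegral_branchWeight_mul_le_of_one hK hl hm hy hg
  · exact setLIntegral_branchWeight_mul_rpow_le hK hl hm hp hy hg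

theorem hardyBound_of_apQuantity_le (hK : 0 < K) (hl : IsWeight lam) (hm : IsWeight mu)
    (hd : InfiniteDiameter K lam) {p : ℝ} (hp : 1 ≤ p) {x : RegularTree K} {r : ℝ} (hr : 0 < r)
    {C : ℝ≥0∞} (h : apQuantity lam mu p x r ≤ C) : HardyBound lam mu p (2 * C) x r := by
  intro g hg
  obtain ⟨hx, hy⟩ := hl.downPoint_spec hK hd x hr.le
  rw [apQuantity_le_iff hl hm hp hr hx] at h
  have h2 : C * ENNReal.ofReal (2 * r ^ p) = 2 * C * ENNReal.ofReal r ^ p := by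
    rw [ENNReal.ofReal_mul two_pos.le, ENNReal.ofReal_rpow_of_pos hr, ENNReal.ofReal_ofNat]
    ring
  rw [h2] at h
  have h1 := setLIntegral_branchWeight_mul_rpow_le_dualFactor hK hl hm hp hy hg
  calc _ ≤ (dualFactor lam mu p x (downPoint lam x r) *
        ∫⁻ w in halfBall lam x r, g w ^ p ∂(radialMeasure K mu)) *
        radialMeasure K mu (halfBall lam (upPoint lam x r) (2 * r)) := by gcongr
    _ = radialMeasure K mu (halfBall lam (upPoint lam x r) (2 * r)) *
        dualFactor lam mu p x (downPoint lam x r) *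
        ∫⁻ w in halfBall lam x r, g w ^ p ∂(radialMeasure K mu) := by ring
    _ ≤ _ := by gcongr

/-- Testing with bounded functions controls the dual factor. -/
theorem mul_dualFactor_le (hK : 0 < K) (hl : IsWeight lam) (hm : IsWeight mu) {p : ℝ} (hp : 1 ≤ p)
    {x y : RegularTree K} {m Q : ℝ≥0∞} (hm0 : m ≠ 0) (hmt : m ≠ ∞)
    (h : ∀ φ : ℝ → ℝ≥0∞, Measurable φ → (∃ N : ℕ, ∀ t, φ t ≤ N) →
      (∫⁻ t in Icc x.height y.height, φ t ∂(lineMeasure lam)) ^ p * m ≤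
        Q * ∫⁻ t in Icc x.height y.height,
          φ t ^ p * ENNReal.ofReal (heightDensity lam mu x t) ∂(lineMeasure lam)) :
    m * dualFactor lam mu p x y ≤ Q := by
  have hmeas := measurable_heightDensity hl.measurable hm.measurable x
  have hpos := heightDensity_pos hK hl.pos hm.pos x
  have hfin : lineMeasure lam (Icc x.height y.height) ≠ ∞ :=
    ((measure_mono (Icc_subset_Icc_left x.height_nonneg)).trans_lt
      (hl.lineMeasure_Icc_lt_top _)).ne
  set ν := (lineMeasure lam).restrict (Icc x.height y.height) with hν
  have hνfin : IsFiniteMeasure ν := ⟨by rw [hν, Measure.restrict_apply_univ]; exact hfin.lt_top⟩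
  rw [mul_comm, ← ENNReal.le_div_iff_mul_le (Or.inl hm0) (Or.inl hmt), dualFactor]
  split_ifs with h1
  · subst h1
    refine essSup_le_of_ae_le _ ?_
    have hφ : Measurable fun t => ENNReal.ofReal (1 / heightDensity lam mu x t) :=
      (measurable_const.div hmeas).ennreal_ofReal
    -- On E one has Q · `heightDensity` < m. If E had positive measure, integrating this strictly
    -- over E would contradict the hypothesis for the indicator of E.
    let E : Set ℝ := {t | ¬ ENNReal.ofReal (1 / heightDensity lam mu x t) ≤ Q / m}
    have hE : MeasurableSet E := (measurableSet_le hφ measurable_const).compl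
    change ν E = 0
    by_contra hE0
    have h2 := h (E.indicator fun _ => 1) (measurable_const.indicator hE)
      ⟨1, fun t => by by_cases ht : t ∈ E <;> simp [ht]⟩
    have h3 : ∀ t, E.indicator (fun _ => (1 : ℝ≥0∞)) t ^ (1 : ℝ) *
        ENNReal.ofReal (heightDensity lam mu x t) =
        E.indicator (fun t => ENNReal.ofReal (heightDensity lam mu x t)) t := by
      intro t; by_cases ht : t ∈ E <;> simp [ht]
    simp only [h3] at h2
    rw [lintegral_indicator hE, lintegral_indicator hE, setLIntegral_one, ENNReal.rpow_one,
      ← lintegral_const_mul _ hmeas.ennreal_ofReal, mul_comm, ← setLIntegral_const] at h2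
    refine absurd h2 (not_le.2 ?_)
    have hlt : ∀ t ∈ E, Q * ENNReal.ofReal (heightDensity lam mu x t) < m := by
      intro t ht
      by_contra! h4
      refine ht ?_
      have hw : ENNReal.ofReal (heightDensity lam mu x t) ≠ 0 := by simpa using hpos t
      rw [one_div, ENNReal.ofReal_inv_of_pos (hpos t),
        ENNReal.le_div_iff_mul_le (Or.inl hm0) (Or.inl hmt)]
      calc _ ≤ (ENNReal.ofReal (heightDensity lam mu x t))⁻¹ *
            (Q * ENNReal.ofReal (heightDensity lam mu x t)) := by gcongr
        _ = Q := by
            rw [mul_comm, mul_assoc, ENNReal.mul_inv_cancel hw ENNReal.ofReal_ne_top, mul_one]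
    refine setLIntegral_strict_mono hE hE0 measurable_const ?_ ?_
    · refine ((setLIntegral_mono' (g := fun _ => m) hE ?_).trans_lt ?_).ne
      · exact fun t ht => (hlt t ht).le
      · rw [setLIntegral_const]; exact ENNReal.mul_lt_top hmt.lt_top (measure_lt_top _ _)
    · exact Filter.Eventually.of_forall hlt
  · have hp1 : 0 < p - 1 := by
      rcases hp.eq_or_lt with h2 | h2
      · exact absurd h2.symm h1
      · linarith
    have hp0 : 0 < p := by linarith
    let ψ : ℝ → ℝ≥0∞ := fun t => ENNReal.ofReal (heightDensity lam mu x t ^ (1 / (1 - p)))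
    have hψ : Measurable ψ := (hmeas.pow_const _).ennreal_ofReal
    -- The extremal function ψ of Hölder's inequality satisfies ψ^p · `heightDensity` = ψ. Its
    -- truncations satisfy this with ≤ and have finite integrals.
    let φ : ℕ → ℝ → ℝ≥0∞ := fun n t => min (ψ t) n
    have hφ : ∀ n, Measurable (φ n) := fun n => hψ.min measurable_const
    have hsup : ∫⁻ t, ψ t ∂ν = ⨆ n, ∫⁻ t, φ n t ∂ν := by
      rw [← lintegral_iSup hφ fun i j hij t => min_le_min_left _ (by exact_mod_cast hij)]
      refine lintegral_congr fun t => ?_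
      have : ⨆ n : ℕ, ψ t ⊓ (n : ℝ≥0∞) = ψ t := by
        rw [← inf_iSup_eq, ENNReal.iSup_natCast, inf_top_eq]
      exact this.symm
    have hbound : ∀ n, ∫⁻ t, φ n t ∂ν ≤ (Q / m) ^ (1 / (p - 1)) := by
      intro n
      have h2 := h (φ n) (hφ n) ⟨n, fun t => min_le_right _ _⟩
      have hle : ∀ t, φ n t ^ p * ENNReal.ofReal (heightDensity lam mu x t) ≤ φ n t := by
        intro t
        have h3 : φ n t ^ (p - 1) * ENNReal.ofReal (heightDensity lam mu x t) ≤ 1 := by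
          calc _ ≤ ψ t ^ (p - 1) * ENNReal.ofReal (heightDensity lam mu x t) := by
                gcongr; exact min_le_left _ _
            _ = 1 := by
                simp only [ψ]
                rw [ENNReal.ofReal_rpow_of_pos (Real.rpow_pos_of_pos (hpos t) _),
                  ← Real.rpow_mul (hpos t).le, ← ENNReal.ofReal_mul
                  (Real.rpow_nonneg (hpos t).le _)]
                have : 1 / (1 - p) * (p - 1) = -1 := by
                  have : 1 - p ≠ 0 := by linarith
                  field_simp; ring
                rw [this, Real.rpow_neg_one, inv_mul_cancel₀ (hpos t).ne', ENNReal.ofReal_one]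
        calc _ = φ n t * (φ n t ^ (p - 1) * ENNReal.ofReal (heightDensity lam mu x t)) := by
              rw [ennreal_rpow_eq_mul _ hp, mul_assoc]
          _ ≤ φ n t * 1 := by gcongr
          _ = _ := mul_one _
      have hafin : ∫⁻ t, φ n t ∂ν ≠ ∞ := by
        refine ((lintegral_mono (g := fun _ => (n : ℝ≥0∞)) fun t => min_le_right _ _).trans_lt ?_).ne
        rw [lintegral_const]
        exact ENNReal.mul_lt_top (ENNReal.natCast_lt_top n) (measure_lt_top _ _)
      -- With a = ∫ φ_n this reads a^p m ≤ Q a. Since a is finite it may be cancelled unless it is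
      -- 0, which leaves a^{p-1} ≤ Q/m uniformly in n.
      have h4 := h2.trans (mul_le_mul_right (lintegral_mono hle) Q)
      generalize ∫⁻ t, φ n t ∂ν = a at h4 hafin
      rcases eq_or_ne a 0 with rfl | ha0
      · exact zero_le
      · rw [one_div, ENNReal.le_rpow_inv_iff hp1,
          ENNReal.le_div_iff_mul_le (Or.inl hm0) (Or.inl hmt)]
        have h5 : a * (a ^ (p - 1) * m) ≤ a * Q := by
          calc _ = a ^ p * m := by
                rw [ennreal_rpow_eq_mul _ hp, mul_assoc]
            _ ≤ _ := h4.trans_eq (mul_comm _ _)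
        exact (ENNReal.mul_le_mul_iff_right ha0 hafin).1 h5
    calc (∫⁻ t, ψ t ∂ν) ^ (p - 1) ≤ ((Q / m) ^ (1 / (p - 1))) ^ (p - 1) := by
          rw [hsup]; gcongr; exact iSup_le hbound
      _ = Q / m := by
          rw [← ENNReal.rpow_mul, one_div_mul_cancel hp1.ne', ENNReal.rpow_one]

/-! ### Doubling from the Hardy inequality -/

theorem IsWeight.le_of_le_of_arc_le (hl : IsWeight lam) {a b z : RegularTree K} (ha : a ≤ z)
    (hb : b ≤ z) (h : arc lam a.height ≤ arc lam b.height) : a ≤ b :=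
  le_of_le_of_height_le ha hb ((hl.arc_le_iff a.height_nonneg b.height_nonneg).1 h)

theorem IsWeight.arc_mono (hl : IsWeight lam) {a b : RegularTree K} (h : a ≤ b) :
    arc lam a.height ≤ arc lam b.height :=
  (hl.arc_le_iff a.height_nonneg b.height_nonneg).2 h.1

theorem IsWeight.le_of_arc_eq_zero (hl : IsWeight lam) {a : RegularTree K}
    (ha : arc lam a.height = 0) (w : RegularTree K) : a ≤ w :=
  (hl.le_of_le_of_arc_le le_rfl (root_le a) (by rw [ha]; exact arc_nonneg _ _)).trans (root_le w)

theorem IsWeight.arc_le_add_treeDist (hl : IsWeight lam) (x y : RegularTree K) :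
    arc lam y.height ≤ arc lam x.height + treeDist lam x y := by
  rw [← hl.treeDist_root, ← hl.treeDist_root]
  exact hl.treeDist_triangle _ _ _

theorem IsWeight.treeDist_le_add (hl : IsWeight lam) (x y : RegularTree K) :
    treeDist lam x y ≤ arc lam x.height + arc lam y.height := by
  rw [← hl.treeDist_root, ← hl.treeDist_root, treeDist_comm (root K) x]
  exact hl.treeDist_triangle _ _ _

theorem IsWeight.measure_treeBall_lt_top (hl : IsWeight lam) (hm : IsWeight mu)
    (hd : InfiniteDiameter K lam) (x : RegularTree K) {r : ℝ} (hr : 0 < r) :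
    radialMeasure K mu (treeBall lam x r) < ∞ :=
  (measure_mono (hl.treeBall_subset_halfBall hd x hr)).trans_lt
    (hl.measure_halfBall_lt_top hm hd _ (by positivity))

theorem IsWeight.measure_treeBall_pos (hK : 0 < K) (hl : IsWeight lam) (hm : IsWeight mu)
    (hd : InfiniteDiameter K lam) (x : RegularTree K) {r : ℝ} (hr : 0 < r) :
    0 < radialMeasure K mu (treeBall lam x r) :=
  (hl.measure_halfBall_pos hK hm hd x hr).trans_le (measure_mono (halfBall_subset_treeBall x r))

/-- Test with the indicator of F(x,s), whose weighted length is exactly s. A small half ball below x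
then controls the large one above it. -/
theorem HardyBound.rpow_mul_measure_le (hK : 0 < K) (hl : IsWeight lam)
    (hd : InfiniteDiameter K lam) (hp : 1 ≤ p) {x : RegularTree K} {r s : ℝ}
    (h : HardyBound lam mu p C x r) (hs : 0 < s) (hsr : s ≤ r) :
    ENNReal.ofReal s ^ p * radialMeasure K mu (halfBall lam (upPoint lam x r) (2 * r)) ≤
      C * ENNReal.ofReal r ^ p * radialMeasure K mu (halfBall lam x s) := by
  have hF := hl.measurableSet_halfBall x s
  have hsub : halfBall lam x s ⊆ halfBall lam x r := fun y hy => ⟨hy.1, hy.2.trans_le hsr⟩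
  have h1 := h ((halfBall lam x s).indicator fun _ => 1) (measurable_const.indicator hF)
  have h2 : ∫⁻ w in halfBall lam x r, branchWeight x w * (halfBall lam x s).indicator (fun _ => 1) w
      ∂(radialMeasure K lam) = ENNReal.ofReal s := by
    obtain ⟨t, h0, hh⟩ := hl.exists_arc_eq hd (s := arc lam x.height + s)
      (add_nonneg (arc_nonneg _ _) hs.le)
    have hxt : x.height ≤ t := (hl.arc_le_iff x.height_nonneg h0).1 (by linarith)
    have h3 := hl.setLIntegral_halfBall_branchWeight hK hl.measurable
      (measurable_const (a := (1 : ℝ≥0∞))) x h0 hh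
    rw [setLIntegral_one, measure_congr Ico_ae_eq_Ioc, hl.lineMeasure_Ioc x.height_nonneg hxt, hh,
      add_sub_cancel_left] at h3
    rw [← h3, ← inter_eq_left.2 hsub, ← Measure.restrict_restrict hF, ← lintegral_indicator hF]
    rw [inter_eq_left.2 hsub]
    refine lintegral_congr fun w => ?_
    by_cases hw : w ∈ halfBall lam x s <;> simp [hw]
  have h4 : ∫⁻ w in halfBall lam x r, (halfBall lam x s).indicator (fun _ => 1) w ^ p
      ∂(radialMeasure K mu) ≤ radialMeasure K mu (halfBall lam x s) := by
    refine (setLIntegral_le_lintegral _ _).trans ?_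
    rw [← lintegral_indicator_one hF]
    refine lintegral_mono fun w => ?_
    by_cases hw : w ∈ halfBall lam x s
    · simp [hw]
    · simp [hw, lt_of_lt_of_le one_pos hp]
  rw [h2] at h1
  exact h1.trans (by gcongr)

/-- The Hardy bound is applied not at x but at a point y at distance r/2 below x. Even if x is the
root, y is far enough from 0 for the weaker hypothesis. -/
theorem measure_treeBall_two_mul_le (hK : 0 < K) (hl : IsWeight lam)
    (hd : InfiniteDiameter K lam) (hp : 1 ≤ p)
    (hH : ∀ (x : RegularTree K) (r : ℝ), 0 < r → r ≤ 8 * arc lam x.height →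
      HardyBound lam mu p C x r) (x : RegularTree K) {r : ℝ} (hr : 0 < r) :
    radialMeasure K mu (treeBall lam x (2 * r)) ≤
      C * 5 ^ p * radialMeasure K mu (treeBall lam x r) := by
  have hx0 := arc_nonneg lam x.height
  obtain ⟨y, hxy, hy⟩ := hl.exists_ge_arc_eq hK hd x (s := arc lam x.height + r / 2) (by linarith)
  -- Going up 5r/2 from y ends where going up 2r from x does, and F(y, r/2) lies in B(x,r). The
  -- radius is admissible since 5r/2 ≤ 8 · (r/2) ≤ 8 d(0,y). The ratio of 5r/2 to r/2 produces 5^p.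
  have h := (hH y (5 * (r / 2)) (by linarith) (by linarith)).rpow_mul_measure_le hK hl hd hp
    (s := r / 2) (by linarith) (by linarith)
  have hsub1 : treeBall lam x (2 * r) ⊆
      halfBall lam (upPoint lam y (5 * (r / 2))) (2 * (5 * (r / 2))) := by
    intro z hz
    obtain ⟨h1, h2⟩ := hl.mem_halfBall.1 (hl.treeBall_subset_halfBall hd x (by linarith) hz)
    obtain ⟨h3, h4⟩ := hl.upPoint_spec hd x (r := 2 * r) (by linarith)
    obtain ⟨h5, h6⟩ := hl.upPoint_spec hd y (r := 5 * (r / 2)) (by linarith)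
    have h7 : arc lam (upPoint lam y (5 * (r / 2))).height =
        arc lam (upPoint lam x (2 * r)).height := by
      rw [h4, h6, hy]
      rcases le_total (2 * r) (arc lam x.height) with hc | hc
      · rw [min_eq_left hc, min_eq_left (by linarith)]; ring
      · rw [min_eq_right hc, min_eq_right (by linarith)]; ring
    rw [hl.mem_halfBall, h7]
    exact ⟨(hl.le_of_le_of_arc_le h5 (h3.trans hxy) h7.le).trans h1, by linarith⟩
  have hsub2 : halfBall lam y (r / 2) ⊆ treeBall lam x r := by
    intro z hz
    obtain ⟨h1, h2⟩ := hl.mem_halfBall.1 hz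
    change treeDist lam x z < r
    rw [hl.treeDist_of_le (hxy.trans h1)]
    linarith
  have hr0 : ENNReal.ofReal (r / 2) ^ p ≠ 0 := by
    rw [ENNReal.ofReal_rpow_of_pos (by linarith)]
    simpa using Real.rpow_pos_of_pos (by linarith : 0 < r / 2) p
  have hrt : ENNReal.ofReal (r / 2) ^ p ≠ ∞ :=
    ENNReal.rpow_ne_top_of_nonneg (by linarith) ENNReal.ofReal_ne_top
  have h5 : ENNReal.ofReal (5 * (r / 2)) ^ p = 5 ^ p * ENNReal.ofReal (r / 2) ^ p := by
    rw [ENNReal.ofReal_mul (by norm_num), ENNReal.mul_rpow_of_nonneg _ _ (by linarith),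
      ENNReal.ofReal_ofNat]
  rw [h5] at h
  rw [← ENNReal.mul_le_mul_iff_right hr0 hrt]
  calc _ ≤ _ := mul_le_mul_right (measure_mono hsub1) _
    _ ≤ _ := h
    _ ≤ C * (5 ^ p * ENNReal.ofReal (r / 2) ^ p) * radialMeasure K mu (treeBall lam x r) := by
        gcongr
    _ = _ := by ring

/-! ### The Poincaré inequality from the Hardy inequality -/

/-- The average is no further from k than the mean of |u - k|, so the constant k may be chosen
freely at the price of a factor 2. -/
theorem ofReal_integral_abs_sub_average_le {α : Type*} [MeasurableSpace α] {ν : Measure α}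
    {B : Set α} (h0 : ν B ≠ 0) (ht : ν B ≠ ∞) {u : α → ℝ} (hu : IntegrableOn u B ν) (k : ℝ) :
    ENNReal.ofReal (⨍ y in B, |u y - ⨍ z in B, u z ∂ν| ∂ν) ≤
      2 * ((ν B)⁻¹ * ∫⁻ y in B, ENNReal.ofReal |u y - k| ∂ν) := by
  let π : Measure α := (ν.restrict B univ)⁻¹ • ν.restrict B
  have hB : ν.restrict B univ = ν B := Measure.restrict_apply_univ B
  have hπ : IsProbabilityMeasure π := ⟨by
    simp only [π, Measure.smul_apply, smul_eq_mul]
    rw [hB, ENNReal.inv_mul_cancel h0 ht]⟩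
  have huπ : Integrable u π := hu.smul_measure (by rw [hB]; exact ENNReal.inv_ne_top.2 h0)
  have hk : Integrable (fun y => |u y - k|) π := (huπ.sub (integrable_const k)).abs
  have h1 : ∫ y, |u y - ∫ z, u z ∂π| ∂π ≤ 2 * ∫ y, |u y - k| ∂π := by
    have h2 : |k - ∫ z, u z ∂π| ≤ ∫ y, |u y - k| ∂π := by
      have : k - ∫ z, u z ∂π = ∫ z, (k - u z) ∂π := by
        rw [integral_sub (integrable_const k) huπ]; simp
      rw [this]
      refine abs_integral_le_integral_abs.trans_eq (integral_congr_ae ?_)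
      exact Filter.Eventually.of_forall fun z => abs_sub_comm _ _
    calc ∫ y, |u y - ∫ z, u z ∂π| ∂π ≤ ∫ y, (|u y - k| + |k - ∫ z, u z ∂π|) ∂π := by
          refine integral_mono (huπ.sub (integrable_const _)).abs
            (hk.add (integrable_const _)) fun y => abs_sub_le _ _ _
      _ = ∫ y, |u y - k| ∂π + |k - ∫ z, u z ∂π| := by
          rw [integral_add hk (integrable_const _)]; simp
      _ ≤ _ := by linarith
  have h3 : ∫⁻ y, ENNReal.ofReal |u y - k| ∂π =
      (ν B)⁻¹ * ∫⁻ y in B, ENNReal.ofReal |u y - k| ∂ν := by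
    simp only [π]
    rw [lintegral_smul_measure, hB, smul_eq_mul]
  rw [← h3, ← ofReal_integral_eq_lintegral_ofReal hk
    (Filter.Eventually.of_forall fun _ => abs_nonneg _), ← ENNReal.ofReal_ofNat 2,
    ← ENNReal.ofReal_mul two_pos.le]
  exact ENNReal.ofReal_le_ofReal h1

/-- By radial symmetry, all points below c at the height of w have the same mass of F(c,r) below
them, so each share is at most the reciprocal of their number. -/
theorem IsWeight.measure_halfBall_inter_Ici_le (hK : 0 < K) (hl : IsWeight lam)
    (hm : IsWeight mu) (hd : InfiniteDiameter K lam) {c w : RegularTree K} {r : ℝ}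
    (hw : w ∈ halfBall lam c r) :
    radialMeasure K mu (halfBall lam c r ∩ Ici w) ≤
      branchWeight c w * radialMeasure K mu (halfBall lam c r) := by
  obtain ⟨hcw, hwr⟩ := hl.mem_halfBall.1 hw
  obtain ⟨h, h0, hh⟩ := hl.exists_arc_eq hd (s := arc lam c.height + r)
    ((arc_nonneg lam w.height).trans hwr.le)
  have e : halfBall lam c r ∩ Ici w =
      halfBall lam w (arc lam c.height + r - arc lam w.height) := by
    ext y
    rw [mem_inter_iff, hl.mem_halfBall, hl.mem_halfBall, mem_Ici]
    exact ⟨fun h => ⟨h.2, by linarith [h.1.2]⟩, fun h => ⟨⟨hcw.trans h.1, by linarith [h.2]⟩, h.1⟩⟩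
  rw [e, hl.measure_halfBall_eq hm w h0 (by rw [hh]; ring), hl.measure_halfBall_eq hm c h0 hh]
  have hk : Measurable fun t : ℝ => (K : ℝ≥0∞) ^ (⌈t⌉₊ - c.generation) :=
    (measurable_from_top (f := fun n : ℕ => (K : ℝ≥0∞) ^ (n - c.generation))).comp
      Nat.measurable_ceil
  calc ∫⁻ t in Ico w.height h, (K : ℝ≥0∞) ^ (⌈t⌉₊ - w.generation) ∂(lineMeasure mu)
      = ∫⁻ t in Ico w.height h, branchWeight c w * (K : ℝ≥0∞) ^ (⌈t⌉₊ - c.generation)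
          ∂(lineMeasure mu) := by
        refine setLIntegral_congr_fun measurableSet_Ico fun t ht => ?_
        have h1 : c.generation ≤ w.generation := Nat.ceil_mono hcw.1
        have h2 : w.generation ≤ ⌈t⌉₊ := Nat.ceil_mono ht.1
        have h3 : ⌈t⌉₊ - c.generation =
            (w.generation - c.generation) + (⌈t⌉₊ - w.generation) := by omega
        rw [branchWeight, h3, pow_add, ← mul_assoc,
          ENNReal.inv_mul_cancel (natCast_pow_ne_zero hK _) (natCast_pow_ne_top _), one_mul]
    _ ≤ ∫⁻ t in Ico c.height h, branchWeight c w * (K : ℝ≥0∞) ^ (⌈t⌉₊ - c.generation)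
          ∂(lineMeasure mu) := lintegral_mono_set (Ico_subset_Ico_left hcw.1)
    _ = _ := lintegral_const_mul _ hk

/-- Interchanging the integrals attaches to g(w) the mass of the part of F(c,r) below w, which the
previous estimate bounds. -/
theorem lintegral_halfBall_geodesic_le (hK : 0 < K) (hl : IsWeight lam)
    (hm : IsWeight mu) (hd : InfiniteDiameter K lam) (c : RegularTree K) (r : ℝ)
    {g : RegularTree K → ℝ≥0∞} (hg : Measurable g) :
    ∫⁻ y in halfBall lam c r, ∫⁻ w in geodesic c y, g w ∂(radialMeasure K lam)
        ∂(radialMeasure K mu) ≤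
      radialMeasure K mu (halfBall lam c r) *
        ∫⁻ w in halfBall lam c r, branchWeight c w * g w ∂(radialMeasure K lam) := by
  have hF := hl.measurableSet_halfBall c r
  let A : Set (RegularTree K × RegularTree K) :=
    {q | q.1 ∈ halfBall lam c r ∧ c ≤ q.2 ∧ q.2 ≤ q.1}
  have hA : MeasurableSet A :=
    (hF.preimage measurable_fst).inter (((measurableSet_Ici_tree c).preimage measurable_snd).inter
      (measurableSet_le_pair.preimage measurable_swap))
  have hAg : Measurable (A.indicator fun q => g q.2) := (hg.comp measurable_snd).indicator hA
  have e1 : ∫⁻ y in halfBall lam c r, ∫⁻ w in geodesic c y, g w ∂(radialMeasure K lam)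
      ∂(radialMeasure K mu) = ∫⁻ y, ∫⁻ w, A.indicator (fun q => g q.2) (y, w)
        ∂(radialMeasure K lam) ∂(radialMeasure K mu) := by
    rw [← lintegral_indicator hF]
    refine lintegral_congr fun y => ?_
    by_cases hy : y ∈ halfBall lam c r
    · rw [indicator_of_mem hy, geodesic_of_le hy.1, ← Ici_inter_Iic, ← lintegral_indicator
        ((measurableSet_Ici_tree c).inter (measurableSet_Iic_tree y))]
      refine lintegral_congr fun w => ?_
      by_cases hw : w ∈ Ici c ∩ Iic y
      · rw [indicator_of_mem hw, indicator_of_mem]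
        exact ⟨hy, hw.1, hw.2⟩
      · rw [indicator_of_notMem hw, indicator_of_notMem]
        exact fun h => hw ⟨h.2.1, h.2.2⟩
    · rw [indicator_of_notMem hy, ← lintegral_zero (μ := radialMeasure K lam)]
      refine lintegral_congr fun w => ?_
      rw [indicator_of_notMem]
      exact fun h => hy h.1
  have hbg : Measurable fun w => branchWeight c w * g w := (measurable_branchWeight c).mul hg
  rw [e1, lintegral_lintegral_swap (f := fun y w => A.indicator (fun q => g q.2) (y, w))
    hAg.aemeasurable, ← lintegral_const_mul _ hbg,
    ← lintegral_indicator hF]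
  refine lintegral_mono fun w => ?_
  have hS : MeasurableSet (halfBall lam c r ∩ Ici w) := hF.inter (measurableSet_Ici_tree w)
  by_cases hw : w ∈ halfBall lam c r
  · rw [indicator_of_mem hw]
    calc ∫⁻ y, A.indicator (fun q => g q.2) (y, w) ∂(radialMeasure K mu)
        ≤ ∫⁻ y, (halfBall lam c r ∩ Ici w).indicator (fun _ => g w) y ∂(radialMeasure K mu) := by
          refine lintegral_mono fun y => ?_
          by_cases hyw : (y, w) ∈ A
          · rw [indicator_of_mem hyw, indicator_of_mem]
            exact ⟨hyw.1, hyw.2.2⟩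
          · rw [indicator_of_notMem hyw]; exact zero_le
      _ = g w * radialMeasure K mu (halfBall lam c r ∩ Ici w) := by
          rw [lintegral_indicator hS, setLIntegral_const]
      _ ≤ g w * (branchWeight c w * radialMeasure K mu (halfBall lam c r)) := by
          gcongr; exact hl.measure_halfBall_inter_Ici_le hK hm hd hw
      _ = _ := by ring
  · rw [indicator_of_notMem hw, ← lintegral_zero (μ := radialMeasure K mu)]
    refine lintegral_mono fun y => ?_
    rw [indicator_of_notMem]
    rintro ⟨h1, h2, h3⟩
    refine hw (hl.mem_halfBall.2 ⟨h2, ?_⟩)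
    exact (hl.arc_mono h3).trans_lt (hl.mem_halfBall.1 h1).2

/-- The same interchange on the segment above c: the points y whose path to c passes w are those of
[0,w]. -/
theorem lintegral_Iic_geodesic_le (c : RegularTree K)
    {g : RegularTree K → ℝ≥0∞} (hg : Measurable g) :
    ∫⁻ y in Iic c, ∫⁻ w in geodesic y c, g w ∂(radialMeasure K lam) ∂(radialMeasure K mu) ≤
      ∫⁻ w in Iic c, radialMeasure K mu (Iic w) * g w ∂(radialMeasure K lam) := by
  have hF := measurableSet_Iic_tree c
  let A : Set (RegularTree K × RegularTree K) := {q | q.1 ≤ q.2 ∧ q.2 ≤ c}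
  have hA : MeasurableSet A := measurableSet_le_pair.inter (hF.preimage measurable_snd)
  have hAg : Measurable (A.indicator fun q => g q.2) := (hg.comp measurable_snd).indicator hA
  have e1 : ∫⁻ y in Iic c, ∫⁻ w in geodesic y c, g w ∂(radialMeasure K lam)
      ∂(radialMeasure K mu) ≤ ∫⁻ y, ∫⁻ w, A.indicator (fun q => g q.2) (y, w)
        ∂(radialMeasure K lam) ∂(radialMeasure K mu) := by
    rw [← lintegral_indicator hF]
    refine lintegral_mono fun y => ?_
    by_cases hy : y ∈ Iic c
    · rw [indicator_of_mem hy, geodesic_of_le hy, ← Ici_inter_Iic, ← lintegral_indicator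
        ((measurableSet_Ici_tree y).inter hF)]
      refine lintegral_mono fun w => ?_
      by_cases hw : w ∈ Ici y ∩ Iic c
      · rw [indicator_of_mem hw, indicator_of_mem]
        exact ⟨hw.1, hw.2⟩
      · rw [indicator_of_notMem hw]; exact zero_le
    · rw [indicator_of_notMem hy]; exact zero_le
  refine e1.trans ?_
  rw [lintegral_lintegral_swap (f := fun y w => A.indicator (fun q => g q.2) (y, w))
    hAg.aemeasurable, ← lintegral_indicator hF]
  refine lintegral_mono fun w => ?_
  by_cases hw : w ∈ Iic c
  · rw [indicator_of_mem hw, mul_comm, ← setLIntegral_const,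
      ← lintegral_indicator (measurableSet_Iic_tree w)]
    refine lintegral_mono fun y => ?_
    by_cases hyw : (y, w) ∈ A
    · rw [indicator_of_mem hyw, indicator_of_mem]
      exact hyw.1
    · rw [indicator_of_notMem hyw]; exact zero_le
  · rw [indicator_of_notMem hw, ← lintegral_zero (μ := radialMeasure K mu)]
    refine lintegral_mono fun y => ?_
    rw [indicator_of_notMem]
    exact fun h => hw h.2

/-- Turns a Hardy bound into an L^p mean over a larger set of mass V: N^p J^p = N^{p-1}(J^p N) ≤
V^{p-1} ρ^p Q = V^p ρ^p (Q/V). -/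
theorem mul_le_of_rpow_mul_le (hp : 1 ≤ p) {N J V ρ Q : ℝ≥0∞} (hV0 : V ≠ 0) (hVt : V ≠ ∞)
    (hNV : N ≤ V) (h : J ^ p * N ≤ ρ ^ p * Q) : N * J ≤ V * (ρ * (Q / V) ^ (1 / p)) := by
  have hp0 : 0 < p := by linarith
  rw [← ENNReal.rpow_le_rpow_iff hp0, ENNReal.mul_rpow_of_nonneg _ _ hp0.le,
    ENNReal.mul_rpow_of_nonneg _ _ hp0.le, ENNReal.mul_rpow_of_nonneg _ _ hp0.le,
    ← ENNReal.rpow_mul, one_div_mul_cancel hp0.ne', ENNReal.rpow_one]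
  calc N ^ p * J ^ p = N ^ (p - 1) * (J ^ p * N) := by rw [ennreal_rpow_eq_mul N hp]; ring
    _ ≤ V ^ (p - 1) * (ρ ^ p * Q) :=
        mul_le_mul' (ENNReal.rpow_le_rpow hNV (by linarith)) h
    _ = V ^ (p - 1) * ρ ^ p * (Q / V * V) := by rw [ENNReal.div_mul_cancel hV0 hVt]; ring
    _ = _ := by rw [ennreal_rpow_eq_mul V hp]; ring

theorem HardyBound.lintegral_halfBall_le (hK : 0 < K) (hl : IsWeight lam)
    (hm : IsWeight mu) (hd : InfiniteDiameter K lam) (hp : 1 ≤ p) {c : RegularTree K} {r : ℝ}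
    (hr : 0 < r) (h : HardyBound lam mu p C c r) {u : RegularTree K → ℝ}
    {g : RegularTree K → ℝ≥0∞} (hg : IsUpperGradient lam g u) {B : Set (RegularTree K)}
    (hB0 : radialMeasure K mu B ≠ 0) (hBt : radialMeasure K mu B ≠ ∞)
    (hcB : halfBall lam c r ⊆ B) :
    ∫⁻ y in halfBall lam c r, ENNReal.ofReal |u y - u c| ∂(radialMeasure K mu) ≤
      radialMeasure K mu B * (ENNReal.ofReal r *
        (C * (∫⁻ y in B, g y ^ p ∂(radialMeasure K mu)) / radialMeasure K mu B) ^ (1 / p)) := by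
  have h1 : ∫⁻ y in halfBall lam c r, ENNReal.ofReal |u y - u c| ∂(radialMeasure K mu) ≤
      radialMeasure K mu (halfBall lam c r) *
        ∫⁻ w in halfBall lam c r, branchWeight c w * g w ∂(radialMeasure K lam) := by
    refine le_trans (lintegral_mono fun y => ?_) (lintegral_halfBall_geodesic_le hK hl hm hd c r hg.1)
    rw [abs_sub_comm]
    exact hg.2 c y
  refine h1.trans (mul_le_of_rpow_mul_le hp hB0 hBt (measure_mono hcB) ?_)
  have hsub : halfBall lam c r ⊆ halfBall lam (upPoint lam c r) (2 * r) := by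
    intro y hy
    obtain ⟨h2, h3⟩ := hl.upPoint_spec hd c hr.le
    obtain ⟨h4, h5⟩ := hl.mem_halfBall.1 hy
    refine hl.mem_halfBall.2 ⟨h2.trans h4, ?_⟩
    linarith [min_le_left r (arc lam c.height)]
  calc _ ≤ _ := mul_le_mul_right (measure_mono hsub) _
    _ ≤ _ := h g hg.1
    _ ≤ C * ENNReal.ofReal r ^ p * ∫⁻ y in B, g y ^ p ∂(radialMeasure K mu) := by
        gcongr
    _ = _ := by ring

theorem branchWeight_eq_one (hK1 : K = 1) (x w : RegularTree K) : branchWeight x w = 1 := by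
  simp [branchWeight, hK1]

theorem le_of_height_le (hK1 : K = 1) {x y : RegularTree K} (h : x.height ≤ y.height) : x ≤ y := by
  subst hK1
  refine ⟨h, ?_⟩
  have hlen : x.vertex.length ≤ y.vertex.length := by
    rw [x.length_vertex, y.length_vertex]; exact Nat.ceil_mono h
  rw [List.prefix_iff_eq_take]
  exact List.ext_getElem (by simpa using hlen) fun _ _ _ => Subsingleton.elim _ _

/-- On the half-line, a dyadic decomposition of the geodesic to the root. -/
theorem lintegral_Iic_le (hK1 : K = 1) (hl : IsWeight lam)
    (hd : InfiniteDiameter K lam) (hp : 1 ≤ p)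
    (hH : ∀ (x : RegularTree K) (r : ℝ), 0 < r → r ≤ 8 * arc lam x.height →
      HardyBound lam mu p C x r) (c : RegularTree K) (hc : 0 < arc lam c.height)
    {u : RegularTree K → ℝ}
    {g : RegularTree K → ℝ≥0∞} (hg : IsUpperGradient lam g u) {B : Set (RegularTree K)}
    (hB0 : radialMeasure K mu B ≠ 0) (hBt : radialMeasure K mu B ≠ ∞)
    (hcB : Iic c ⊆ B) :
    ∫⁻ y in Iic c, ENNReal.ofReal |u y - u c| ∂(radialMeasure K mu) ≤
      radialMeasure K mu B * (2 * ENNReal.ofReal (arc lam c.height) *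
        (C * (∫⁻ y in B, g y ^ p ∂(radialMeasure K mu)) / radialMeasure K mu B) ^ (1 / p)) := by
  set s := arc lam c.height with hs
  set E := ∫⁻ y in B, g y ^ p ∂(radialMeasure K mu)
  set V := radialMeasure K mu B
  have h1 : ∫⁻ y in Iic c, ENNReal.ofReal |u y - u c| ∂(radialMeasure K mu) ≤
      ∫⁻ w in Iic c, radialMeasure K mu (Iic w) * g w ∂(radialMeasure K lam) :=
    le_trans (lintegral_mono fun y => hg.2 y c) (lintegral_Iic_geodesic_le c hg.1)
  -- Dyadic points on [0,c]; the segments from a(k+1) to a(k) cover [0,c] up to the root.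
  have hpts : ∀ k : ℕ, ∃ a, a ≤ c ∧ arc lam a.height = s / 2 ^ k := fun k =>
    hl.exists_le_arc_eq hd c (by positivity)
      (div_le_self hc.le (one_le_pow₀ one_le_two))
  choose a hac ha using hpts
  have hcover : Iic c ⊆ Iic (root K) ∪ ⋃ k : ℕ, (Iic (a k) \ Iic (a (k + 1))) := by
    intro w hw
    rcases (arc_nonneg lam w.height).eq_or_lt with h0 | h0
    · exact Or.inl (hl.le_of_arc_eq_zero h0.symm _)
    · refine Or.inr (mem_iUnion.2 ?_)
      have hex : ∃ n : ℕ, arc lam (a n).height < arc lam w.height := by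
        obtain ⟨n, hn⟩ := exists_pow_lt_of_lt_one (div_pos h0 hc) (by norm_num : (1 / 2 : ℝ) < 1)
        refine ⟨n, ?_⟩
        rw [ha, div_eq_mul_inv, ← inv_pow, ← one_div (2 : ℝ)]
        rw [lt_div_iff₀ hc] at hn
        linarith
      classical
      have hn := Nat.find_spec hex
      have hmin := fun m => Nat.find_min hex (m := m)
      generalize Nat.find hex = n at hn hmin
      rcases n with _ | k
      · rw [ha, pow_zero, div_one] at hn
        exact absurd (hl.arc_mono hw) (not_le.2 hn)
      · refine ⟨k, hl.le_of_le_of_arc_le hw (hac k) (not_lt.1 (hmin k (Nat.lt_succ_self k))), ?_⟩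
        exact fun h => absurd (hl.arc_mono h) (not_le.2 hn)
  have hterm : ∀ k : ℕ, ∫⁻ w in Iic (a k) \ Iic (a (k + 1)), radialMeasure K mu (Iic w) * g w
      ∂(radialMeasure K lam) ≤ V * (ENNReal.ofReal s * 2⁻¹ ^ k * (C * E / V) ^ (1 / p)) := by
    intro k
    have hD : MeasurableSet (Iic (a k) \ Iic (a (k + 1))) :=
      (measurableSet_Iic_tree _).diff (measurableSet_Iic_tree _)
    have hr : s / 2 ^ k = 2 * arc lam (a (k + 1)).height := by
      rw [ha, pow_succ]; field_simp
    have hr0 : 0 < s / 2 ^ k := by positivity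
    have hle : a (k + 1) ≤ a k := hl.le_of_le_of_arc_le (hac _) (hac _) (by rw [ha k, hr]; linarith)
    -- The radius is 2 d(0, a(k+1)), so the far condition holds and the half ball upwards starts at
    -- the root and contains [0, a(k)]. The half ball at a(k+1) reaches beyond a(k), for k = 0 even
    -- beyond c and possibly out of B; hence g is cut off at c.
    have hh := hH (a (k + 1)) (s / 2 ^ k) hr0 (by rw [hr]; linarith)
      ((Iic c).indicator g) (hg.1.indicator (measurableSet_Iic_tree c))
    have hsub : Iic (a k) \ Iic (a (k + 1)) ⊆ halfBall lam (a (k + 1)) (s / 2 ^ k) := by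
      rintro w ⟨hw1, hw2⟩
      refine hl.mem_halfBall.2 ⟨(le_total_of_le hle hw1).resolve_right hw2, ?_⟩
      have h2 := hl.arc_mono hw1
      rw [ha k] at h2
      linarith
    have hsub2 : Iic (a k) ⊆
        halfBall lam (upPoint lam (a (k + 1)) (s / 2 ^ k)) (2 * (s / 2 ^ k)) := by
      intro w hw
      obtain ⟨_, h3⟩ := hl.upPoint_spec hd (a (k + 1)) hr0.le
      rw [min_eq_right (by linarith), sub_self] at h3
      refine hl.mem_halfBall.2 ⟨hl.le_of_arc_eq_zero h3 w, ?_⟩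
      have h2 := hl.arc_mono hw
      rw [ha k] at h2
      linarith
    have hJ : ∫⁻ w in Iic (a k) \ Iic (a (k + 1)), g w ∂(radialMeasure K lam) ≤
        ∫⁻ w in halfBall lam (a (k + 1)) (s / 2 ^ k),
          branchWeight (a (k + 1)) w * (Iic c).indicator g w ∂(radialMeasure K lam) := by
      refine le_trans ?_ (lintegral_mono_set hsub)
      refine (setLIntegral_congr_fun hD fun w hw => ?_).le
      rw [branchWeight_eq_one hK1, one_mul, indicator_of_mem]
      exact (mem_Iic.1 hw.1).trans (hac k)
    have hE : ∫⁻ w in halfBall lam (a (k + 1)) (s / 2 ^ k), (Iic c).indicator g w ^ p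
        ∂(radialMeasure K mu) ≤ E := by
      refine (setLIntegral_le_lintegral _ _).trans (le_trans ?_ (lintegral_mono_set hcB))
      rw [← lintegral_indicator (measurableSet_Iic_tree c)]
      refine lintegral_mono fun w => ?_
      by_cases hw : w ∈ Iic c
      · rw [indicator_of_mem hw, indicator_of_mem hw]
      · rw [indicator_of_notMem hw, ENNReal.zero_rpow_of_pos (by linarith)]; exact zero_le
    have hρ : ENNReal.ofReal s * 2⁻¹ ^ k = ENNReal.ofReal (s / 2 ^ k) := by
      rw [ENNReal.ofReal_div_of_pos (by positivity), ENNReal.ofReal_pow two_pos.le,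
        ENNReal.ofReal_ofNat, div_eq_mul_inv, ENNReal.inv_pow]
    calc _ ≤ ∫⁻ w in Iic (a k) \ Iic (a (k + 1)), radialMeasure K mu (Iic (a k)) * g w
          ∂(radialMeasure K lam) := by
          refine setLIntegral_mono' hD fun w hw => ?_
          gcongr
          exact mem_Iic.1 hw.1
      _ = radialMeasure K mu (Iic (a k)) * ∫⁻ w in Iic (a k) \ Iic (a (k + 1)), g w
          ∂(radialMeasure K lam) := lintegral_const_mul _ hg.1
      _ ≤ _ := by
          rw [hρ]
          refine mul_le_of_rpow_mul_le hp hB0 hBt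
            (measure_mono ((Iic_subset_Iic.2 (hac k)).trans hcB)) ?_
          calc _ ≤ _ := mul_le_mul' (ENNReal.rpow_le_rpow hJ (by linarith)) (measure_mono hsub2)
            _ ≤ _ := hh
            _ ≤ C * ENNReal.ofReal (s / 2 ^ k) ^ p * E := by gcongr
            _ = _ := by ring
  have hroot : ∫⁻ w in Iic (root K), radialMeasure K mu (Iic w) * g w ∂(radialMeasure K lam) = 0 := by
    refine setLIntegral_measure_zero _ _ ?_
    rw [hl.radialMeasure_Iic, show (root K).height = 0 from rfl, arc_zero, ENNReal.ofReal_zero]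
  calc _ ≤ _ := h1
    _ ≤ _ := lintegral_mono_set hcover
    _ ≤ _ := lintegral_union_le _ _ _
    _ ≤ 0 + ∑' k : ℕ, ∫⁻ w in Iic (a k) \ Iic (a (k + 1)), radialMeasure K mu (Iic w) * g w
      ∂(radialMeasure K lam) := add_le_add hroot.le (lintegral_iUnion_le _ _)
    _ ≤ ∑' k : ℕ, V * (ENNReal.ofReal s * 2⁻¹ ^ k * (C * E / V) ^ (1 / p)) := by
      rw [zero_add]; exact ENNReal.tsum_le_tsum hterm
    _ = V * (2 * ENNReal.ofReal s * (C * E / V) ^ (1 / p)) := by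
      rw [ENNReal.tsum_mul_left, ENNReal.tsum_mul_right, ENNReal.tsum_mul_left,
        ENNReal.tsum_geometric, ENNReal.one_sub_inv_two, inv_inv, mul_comm (ENNReal.ofReal s)]

/-- The constant k is the value of u at a point c through which the ball is reached: x̄^r in
general, and the point at distance r from 0 when K = 1 and x is close to 0. -/
theorem lintegral_treeBall_abs_sub_le (hK : 0 < K) (hl : IsWeight lam)
    (hm : IsWeight mu) (hd : InfiniteDiameter K lam) (hp : 1 ≤ p)
    (hH : ∀ (x : RegularTree K) (r : ℝ), 0 < r → (2 ≤ K ∨ r ≤ 8 * arc lam x.height) →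
      HardyBound lam mu p C x r) (x : RegularTree K) {r : ℝ} (hr : 0 < r)
    {u : RegularTree K → ℝ} {g : RegularTree K → ℝ≥0∞} (hg : IsUpperGradient lam g u) :
    ∃ k : ℝ, ∫⁻ y in treeBall lam x r, ENNReal.ofReal |u y - k| ∂(radialMeasure K mu) ≤
      radialMeasure K mu (treeBall lam x (8 * r)) * (4 * ENNReal.ofReal r *
        (C * (∫⁻ y in treeBall lam x (8 * r), g y ^ p ∂(radialMeasure K mu)) /
          radialMeasure K mu (treeBall lam x (8 * r))) ^ (1 / p)) := by
  have h8 : 0 < 8 * r := by linarith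
  have hB0 := (hl.measure_treeBall_pos hK hm hd x h8).ne'
  have hBt := (hl.measure_treeBall_lt_top hm hd x h8).ne
  have h2r : ENNReal.ofReal (2 * r) = 2 * ENNReal.ofReal r := by
    rw [ENNReal.ofReal_mul two_pos.le, ENNReal.ofReal_ofNat]
  set V := radialMeasure K mu (treeBall lam x (8 * r))
  set E := ∫⁻ y in treeBall lam x (8 * r), g y ^ p ∂(radialMeasure K mu)
  -- For c = x̄^r and radius 2r the far condition reads 2r ≤ 8(d(0,x) - r), that is, 5r ≤ 4 d(0,x).
  by_cases hcase : 2 ≤ K ∨ 5 * r ≤ 4 * arc lam x.height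
  · obtain ⟨hcx, hc⟩ := hl.upPoint_spec hd x hr.le
    refine ⟨u (upPoint lam x r), ?_⟩
    have hsub := hl.treeBall_subset_halfBall hd x hr
    set c := upPoint lam x r
    have hh : HardyBound lam mu p C c (2 * r) := hH c (2 * r) (by linarith) <| hcase.imp id fun h => by
      rw [hc, min_eq_left (by linarith)]; linarith
    have hcB : halfBall lam c (2 * r) ⊆ treeBall lam x (8 * r) := by
      intro y hy
      change treeDist lam x y < 8 * r
      have h1 := hl.treeDist_triangle x c y
      rw [treeDist_comm x c, hl.treeDist_of_le hcx, hc] at h1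
      linarith [min_le_left r (arc lam x.height), hy.2]
    refine (lintegral_mono_set hsub).trans
      ((hh.lintegral_halfBall_le hK hl hm hd hp (by linarith) hg hB0 hBt hcB).trans ?_)
    rw [h2r]
    gcongr
    norm_num
  · push Not at hcase
    have hK1 : K = 1 := by omega
    -- Now d(0,x) < 5r/4, so B(x,r) lies within distance 9r/4 of 0, hence in [0,c] ∪ F(c,2r) with
    -- d(0,c) = r. Points at distance less than 3r from 0 stay in B(x,8r). Each piece contributes a
    -- factor 2r.
    obtain ⟨t, ht, hts⟩ := hl.exists_arc_eq hd hr.le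
    obtain ⟨c, -, rfl⟩ := exists_height_eq_of_prefix hK ([] : TreeVertex K) ht (Nat.zero_le _)
    refine ⟨u c, ?_⟩
    have hsub : treeBall lam x r ⊆ Iic c ∪ halfBall lam c (2 * r) := by
      intro y hy
      rcases le_total y.height c.height with h | h
      · exact Or.inl (le_of_height_le hK1 h)
      · refine Or.inr (hl.mem_halfBall.2 ⟨le_of_height_le hK1 h, ?_⟩)
        have h1 := hl.arc_le_add_treeDist x y
        have h2 : treeDist lam x y < r := hy
        linarith [hcase.2]
    have hball : ∀ y : RegularTree K, arc lam y.height < 3 * r → y ∈ treeBall lam x (8 * r) := by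
      intro y hy
      change treeDist lam x y < 8 * r
      linarith [hl.treeDist_le_add x y, hcase.2]
    have h1 := lintegral_Iic_le hK1 hl hd hp (fun x r hr h => hH x r hr (Or.inr h)) c
      (by rw [hts]; exact hr) hg hB0 hBt
      fun y hy => hball y (by linarith [hl.arc_mono (mem_Iic.1 hy)])
    have h2 := (hH c (2 * r) (by linarith) (Or.inr (by linarith))).lintegral_halfBall_le hK hl hm hd
      hp (by linarith) hg hB0 hBt fun y hy => hball y (by linarith [(hl.mem_halfBall.1 hy).2])
    rw [hts] at h1
    rw [h2r] at h2
    refine (lintegral_mono_set hsub).trans ((lintegral_union_le _ _ _).trans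
      ((add_le_add h1 h2).trans_eq ?_))
    ring

theorem isDoublingTree_of_hardyBound (hK : 0 < K) (hl : IsWeight lam)
    (hd : InfiniteDiameter K lam) (hp : 1 ≤ p) (hC : C ≠ ∞)
    (hH : ∀ (x : RegularTree K) (r : ℝ), 0 < r → r ≤ 8 * arc lam x.height →
      HardyBound lam mu p C x r) : IsDoublingTree K lam mu := by
  have hfin : C * 5 ^ p ≠ ∞ :=
    ENNReal.mul_ne_top hC (ENNReal.rpow_ne_top_of_nonneg (by linarith) (by norm_num))
  refine ⟨(C * 5 ^ p).toReal + 1, by positivity, fun x r hr => ?_⟩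
  refine (measure_treeBall_two_mul_le hK hl hd hp hH x hr).trans ?_
  gcongr
  rw [← ENNReal.toReal_le_toReal hfin ENNReal.ofReal_ne_top, ENNReal.toReal_ofReal (by positivity)]
  linarith

theorem supportsPoincare_of_hardyBound (hK : 0 < K) (hl : IsWeight lam) (hm : IsWeight mu)
    (hd : InfiniteDiameter K lam) (hp : 1 ≤ p) (hC : C ≠ ∞)
    (hH : ∀ (x : RegularTree K) (r : ℝ), 0 < r → (2 ≤ K ∨ r ≤ 8 * arc lam x.height) →
      HardyBound lam mu p C x r) : SupportsPoincare K lam mu p := by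
  have hp0 : 0 < p := by linarith
  set D : ℝ≥0∞ := C * 5 ^ p with hD
  have hDt : D ≠ ∞ :=
    ENNReal.mul_ne_top hC (ENNReal.rpow_ne_top_of_nonneg hp0.le (by norm_num))
  have hdbl := measure_treeBall_two_mul_le hK hl hd hp fun x r hr h => hH x r hr (Or.inr h)
  -- The factor 8 is 2 (replacing the average by k) times 4 (from the oscillation estimate); D^3
  -- comes from three doublings between B(x,r) and B(x,8r).
  set Q : ℝ≥0∞ := 8 * D ^ 3 * C ^ (1 / p) with hQ
  have hQt : Q ≠ ∞ := ENNReal.mul_ne_top (ENNReal.mul_ne_top (by norm_num) (ENNReal.pow_ne_top hDt))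
    (ENNReal.rpow_ne_top_of_nonneg (by positivity) hC)
  refine ⟨Q.toReal + 1, 8, by positivity, by norm_num, fun x r hr u g hu hg => ?_⟩
  obtain ⟨k, hk⟩ := lintegral_treeBall_abs_sub_le hK hl hm hd hp hH x hr hg
  have hm0 := (hl.measure_treeBall_pos hK hm hd x hr).ne'
  have hmt := (hl.measure_treeBall_lt_top hm hd x hr).ne
  have hsub : treeBall lam x r ⊆ treeBall lam x (8 * r) := fun y hy =>
    (show treeDist lam x y < r from hy).trans_le (by linarith)
  have h1 := ofReal_integral_abs_sub_average_le hm0 hmt (hu.mono_set hsub) k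
  have hV : radialMeasure K mu (treeBall lam x (8 * r)) ≤
      D ^ 3 * radialMeasure K mu (treeBall lam x r) := by
    calc _ = radialMeasure K mu (treeBall lam x (2 * (2 * (2 * r)))) := by congr 2; ring
      _ ≤ D * (D * (D * radialMeasure K mu (treeBall lam x r))) :=
          (hdbl x (by linarith)).trans (mul_le_mul_right ((hdbl x (by linarith)).trans
            (mul_le_mul_right (hdbl x hr) _)) _)
      _ = _ := by ring
  rw [setLAverage_eq]
  refine h1.trans ?_
  set V := radialMeasure K mu (treeBall lam x (8 * r))
  set m := radialMeasure K mu (treeBall lam x r)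
  set E := ∫⁻ y in treeBall lam x (8 * r), g y ^ p ∂(radialMeasure K mu)
  have hfac : (C * E / V) ^ (1 / p) = C ^ (1 / p) * (E / V) ^ (1 / p) := by
    rw [mul_div_assoc, ENNReal.mul_rpow_of_nonneg _ _ (by positivity)]
  have hQle : Q ≤ ENNReal.ofReal (Q.toReal + 1) := by
    rw [← ENNReal.toReal_le_toReal hQt ENNReal.ofReal_ne_top, ENNReal.toReal_ofReal (by positivity)]
    linarith
  calc _ ≤ 2 * (m⁻¹ * (V * (4 * ENNReal.ofReal r * (C * E / V) ^ (1 / p)))) := by gcongr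
    _ ≤ 2 * (m⁻¹ * (D ^ 3 * m * (4 * ENNReal.ofReal r * (C * E / V) ^ (1 / p)))) := by gcongr
    _ = (m⁻¹ * m) * (Q * ENNReal.ofReal r * (E / V) ^ (1 / p)) := by rw [hfac, hQ]; ring
    _ = Q * ENNReal.ofReal r * (E / V) ^ (1 / p) := by
        rw [ENNReal.inv_mul_cancel hm0 hmt, one_mul]
    _ ≤ _ := by
        rw [ENNReal.ofReal_mul (by positivity)]
        gcongr

/-! ### Test functions: from admissibility to A_p -/

/-- Whatever the average k is, a ≤ |a - k| + |k|. The two terms are the oscillations on Y and on Z,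
each of which carries at least the fraction 1/T of the mass of B. -/
theorem ofReal_le_integral_abs_sub_average {α : Type*} [MeasurableSpace α] {ν : Measure α}
    {B Y Z : Set α} (h0 : ν B ≠ 0) (ht : ν B ≠ ∞) {u : α → ℝ} (hu : IntegrableOn u B ν) {a : ℝ}
    (hY : MeasurableSet Y) (hZ : MeasurableSet Z) (hYB : Y ⊆ B) (hZB : Z ⊆ B)
    (huY : ∀ y ∈ Y, u y = a) (huZ : ∀ z ∈ Z, u z = 0) {T : ℝ≥0∞}
    (hTY : ν B ≤ T * ν Y) (hTZ : ν B ≤ T * ν Z) :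
    ENNReal.ofReal a ≤ 2 * T * ENNReal.ofReal (⨍ y in B, |u y - ⨍ z in B, u z ∂ν| ∂ν) := by
  generalize (⨍ z in B, u z ∂ν) = k
  have hk : IntegrableOn (fun y => |u y - k|) B ν := (hu.sub (integrableOn_const ht)).abs
  have hreal : ν.real B ≠ 0 := (ENNReal.toReal_pos h0 ht).ne'
  have h1 : ENNReal.ofReal (⨍ y in B, |u y - k| ∂ν) =
      (ν B)⁻¹ * ∫⁻ y in B, ENNReal.ofReal |u y - k| ∂ν := by
    rw [setAverage_eq, smul_eq_mul, ENNReal.ofReal_mul (by positivity),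
      ENNReal.ofReal_inv_of_pos (lt_of_le_of_ne measureReal_nonneg hreal.symm), Measure.real,
      ENNReal.ofReal_toReal ht, ofReal_integral_eq_lintegral_ofReal hk
      (Filter.Eventually.of_forall fun _ => abs_nonneg _)]
  rw [h1]
  set I := ∫⁻ y in B, ENNReal.ofReal |u y - k| ∂ν
  have hIY : ENNReal.ofReal |a - k| * ν Y ≤ I := by
    rw [← setLIntegral_const]
    refine le_trans (setLIntegral_mono' hY fun y hy => ?_) (lintegral_mono_set hYB)
    rw [huY y hy]
  have hIZ : ENNReal.ofReal |k| * ν Z ≤ I := by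
    rw [← setLIntegral_const]
    refine le_trans (setLIntegral_mono' hZ fun y hy => ?_) (lintegral_mono_set hZB)
    rw [huZ y hy, zero_sub, abs_neg]
  have ha : ENNReal.ofReal a ≤ ENNReal.ofReal |a - k| + ENNReal.ofReal |k| := by
    rw [← ENNReal.ofReal_add (abs_nonneg _) (abs_nonneg _)]
    refine ENNReal.ofReal_le_ofReal ?_
    linarith [le_abs_self (a - k), le_abs_self k]
  have h2 : ENNReal.ofReal a * ν B ≤ 2 * T * I := by
    calc _ ≤ (ENNReal.ofReal |a - k| + ENNReal.ofReal |k|) * ν B := by gcongr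
      _ = ENNReal.ofReal |a - k| * ν B + ENNReal.ofReal |k| * ν B := add_mul _ _ _
      _ ≤ ENNReal.ofReal |a - k| * (T * ν Y) + ENNReal.ofReal |k| * (T * ν Z) := by gcongr
      _ = T * (ENNReal.ofReal |a - k| * ν Y) + T * (ENNReal.ofReal |k| * ν Z) := by ring
      _ ≤ T * I + T * I := by gcongr
      _ = _ := by ring
  calc _ ≤ 2 * T * I / ν B := by rwa [ENNReal.le_div_iff_mul_le (Or.inl h0) (Or.inl ht)]
    _ = _ := by rw [div_eq_mul_inv]; ring

theorem ofReal_abs_toReal_sub_le {a b G : ℝ≥0∞} (ha : a ≠ ∞) (hb : b ≠ ∞) (h1 : a ≤ b + G)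
    (h2 : b ≤ a + G) : ENNReal.ofReal |a.toReal - b.toReal| ≤ G := by
  rcases eq_or_ne G ∞ with rfl | hG
  · exact le_top
  · refine ENNReal.ofReal_le_of_le_toReal (abs_sub_le_iff.2 ⟨?_, ?_⟩)
    · have := ENNReal.toReal_mono (ENNReal.add_ne_top.2 ⟨hb, hG⟩) h1
      rw [ENNReal.toReal_add hb hG] at this
      linarith
    · have := ENNReal.toReal_mono (ENNReal.add_ne_top.2 ⟨ha, hG⟩) h2
      rw [ENNReal.toReal_add ha hG] at this
      linarith

/-- The potential `∫_[0, z] g ds`. -/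
def potential (lam : ℝ → ℝ) (g : RegularTree K → ℝ≥0∞) (z : RegularTree K) : ℝ≥0∞ :=
  ∫⁻ w in Iic z, g w ∂(radialMeasure K lam)

theorem measurable_potential {g : RegularTree K → ℝ≥0∞} (hg : Measurable g) :
    Measurable (potential lam g) := by
  let A : Set (RegularTree K × RegularTree K) := {q | q.2 ≤ q.1}
  have hA : MeasurableSet A := measurableSet_le_pair.preimage measurable_swap
  have h : Measurable (A.indicator fun q => g q.2) := (hg.comp measurable_snd).indicator hA
  have h2 := h.lintegral_prod_right' (ν := radialMeasure K lam)
  have e : potential lam g = fun z => ∫⁻ w, A.indicator (fun q => g q.2) (z, w)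
      ∂(radialMeasure K lam) := by
    ext z
    rw [potential, ← lintegral_indicator (measurableSet_Iic_tree z)]
    rfl
  rw [e]
  exact h2

/-- Because [0,z] ⊆ [0,y] ∪ [z,y]; by symmetry g is then an upper gradient of its potential. -/
theorem potential_le_add (g : RegularTree K → ℝ≥0∞) (z y : RegularTree K) :
    potential lam g z ≤ potential lam g y +
      ∫⁻ w in geodesic z y, g w ∂(radialMeasure K lam) := by
  refine le_trans (lintegral_mono_set fun w hw => ?_) (lintegral_union_le _ _ _)
  by_cases h : w ∈ Iic y
  · exact Or.inl h
  · exact Or.inr (symmDiff_subset_geodesic z y (Or.inl ⟨hw, h⟩))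

theorem isUpperGradient_potential {g : RegularTree K → ℝ≥0∞} (hg : Measurable g)
    (hfin : ∀ z, potential lam g z ≠ ∞) :
    IsUpperGradient lam g fun z => (potential lam g z).toReal := by
  refine ⟨hg, fun z y => ofReal_abs_toReal_sub_le (hfin z) (hfin y) (potential_le_add g z y) ?_⟩
  rw [geodesic_comm]
  exact potential_le_add g y z

/-- A path between points in different branches at the root contains all of [0,z] up to the root. -/
theorem IsWeight.le_treeDist_of_meet_le_root (hl : IsWeight lam) {z y : RegularTree K}
    (h : ∀ w, w ≤ z → w ≤ y → w ≤ root K) : arc lam z.height ≤ treeDist lam z y := by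
  have h1 : Iic z ⊆ symmDiff (Iic z) (Iic y) ∪ Iic (root K) := by
    intro w hw
    by_cases hwy : w ∈ Iic y
    · exact Or.inr (h w hw hwy)
    · exact Or.inl (Or.inl ⟨hw, hwy⟩)
  have h2 := (measure_mono h1).trans (measure_union_le (μ := radialMeasure K lam) _ _)
  rw [hl.radialMeasure_Iic, hl.radialMeasure_Iic, show (root K).height = 0 from rfl, arc_zero,
    ENNReal.ofReal_zero, add_zero] at h2
  rw [treeDist_eq hl.measurable]
  exact (ENNReal.ofReal_le_iff_le_toReal (hl.radialMeasure_symmDiff_lt_top _ _).ne).1 h2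

/-- Near every point there is a ball which stays away from some branch below the point. -/
theorem exists_branch_and_disjoint_ball (hl : IsWeight lam)
    (hd : InfiniteDiameter K lam) (x : RegularTree K) {r : ℝ} (hr : 0 < r)
    (hcase : 2 ≤ K ∨ r ≤ 8 * arc lam x.height) :
    ∃ (v : TreeVertex K) (c : RegularTree K), x.vertex <+: v ∧
      (∀ t, x.height < t → v.length ≤ ⌈t⌉₊) ∧ treeDist lam x c ≤ r / 4 ∧
      ∀ z ∈ treeBall lam c (r / 8), v <+: z.vertex → z.height ≤ x.height := by
  -- Far from 0 the centre is taken at distance r/8 above x, and a ball of radius r/8 does not get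
  -- past x.
  by_cases hx : r ≤ 8 * arc lam x.height
  · obtain ⟨c, hc, hcx⟩ := hl.exists_le_arc_eq hd x (s := arc lam x.height - r / 8) (by linarith)
      (by linarith)
    refine ⟨x.vertex, c, List.prefix_refl _, fun t ht => ?_, ?_, fun z hz hv => ?_⟩
    · rw [x.length_vertex]; exact Nat.ceil_mono ht.le
    · rw [treeDist_comm, hl.treeDist_of_le hc, hcx]; linarith
    · by_contra! h
      have hxz : x ≤ z := ⟨h.le, hv⟩
      have h1 : treeDist lam c z < r / 8 := hz
      rw [hl.treeDist_of_le (hc.trans hxz), hcx] at h1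
      linarith [hl.arc_mono hxz]
  · have hK2 : 2 ≤ K := hcase.resolve_right hx
    -- Close to 0 the centre goes into another branch at the root, at distance r/8 from it. If x is
    -- the root, its empty word selects no branch, so v is taken to be a child.
    obtain ⟨b, l, hv, hlen⟩ : ∃ (b : Fin K) (l : TreeVertex K), x.vertex <+: b :: l ∧
        ∀ t, x.height < t → (b :: l).length ≤ ⌈t⌉₊ := by
      rcases hxv : x.vertex with _ | ⟨b, l⟩
      · refine ⟨⟨0, by omega⟩, [], List.nil_prefix, fun t ht => ?_⟩
        exact Nat.one_le_ceil_iff.2 (x.height_nonneg.trans_lt ht)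
      · refine ⟨b, l, List.prefix_refl _, fun t ht => ?_⟩
        rw [← hxv, x.length_vertex]; exact Nat.ceil_mono ht.le
    obtain ⟨b', hb'⟩ : ∃ b' : Fin K, b' ≠ b := by
      have : Nontrivial (Fin K) := Fin.nontrivial_iff_two_le.2 hK2
      exact exists_ne b
    obtain ⟨t, ht, hts⟩ := hl.exists_arc_eq hd (s := r / 8) (by linarith)
    have ht0 : 0 < t := ht.lt_of_ne (by rintro rfl; rw [arc_zero] at hts; linarith)
    obtain ⟨c, hc, hct⟩ := exists_height_eq_of_prefix (by omega) [b'] ht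
      (Nat.one_le_ceil_iff.2 ht0)
    refine ⟨b :: l, c, hv, hlen, ?_, fun z hz hvz => ?_⟩
    · have := hl.treeDist_le_add x c
      rw [hct, hts] at this
      linarith
    · have h1 : treeDist lam c z < r / 8 := hz
      have h2 := hl.le_treeDist_of_meet_le_root (z := c) (y := z) fun w hwc hwz => by
        have hw : w.vertex = [] := by
          obtain ⟨l1, h1⟩ := hc
          obtain ⟨l2, h2⟩ := hvz
          have h3 := hwc.2
          have h4 := hwz.2
          rw [← h1] at h3
          rw [← h2] at h4
          rcases hw : w.vertex with _ | ⟨d, l3⟩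
          · rfl
          · rw [hw] at h3 h4
            have h5 : d = b' := (List.cons_prefix_cons.1 h3).1
            have h6 : d = b := (List.cons_prefix_cons.1 h4).1
            exact absurd (h5.symm.trans h6) hb'
        have h7 := w.length_vertex
        rw [hw, List.length_nil, eq_comm, Nat.ceil_eq_zero] at h7
        exact ⟨h7, by rw [hw]; exact List.nil_prefix⟩
      rw [hct, hts] at h2
      exact absurd h1 (not_lt.2 h2)

theorem measure_treeBall_two_pow_mul_le
    (hD : ∀ (x : RegularTree K) (r : ℝ), 0 < r → radialMeasure K mu (treeBall lam x (2 * r)) ≤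
      D * radialMeasure K mu (treeBall lam x r)) (x : RegularTree K) {r : ℝ} (hr : 0 < r) (n : ℕ) :
    radialMeasure K mu (treeBall lam x (2 ^ n * r)) ≤
      D ^ n * radialMeasure K mu (treeBall lam x r) := by
  induction n with
  | zero => simp
  | succ n ih =>
    calc _ = radialMeasure K mu (treeBall lam x (2 * (2 ^ n * r))) := by congr 2; ring
      _ ≤ D * (D ^ n * radialMeasure K mu (treeBall lam x r)) :=
          (hD x _ (by positivity)).trans (mul_le_mul_right ih _)
      _ = _ := by ring

/-- The radial function `ψ` restricted to the branch at `v`. -/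
def branchFunction (v : TreeVertex K) (ψ : ℝ → ℝ≥0∞) (w : RegularTree K) : ℝ≥0∞ :=
  {w : RegularTree K | v <+: w.vertex}.indicator (fun w => ψ w.height) w

theorem measurable_branchFunction (v : TreeVertex K) {ψ : ℝ → ℝ≥0∞} (hψ : Measurable ψ) :
    Measurable (branchFunction v ψ) :=
  (hψ.comp measurable_height).indicator
    (measurable_vertex (MeasurableSet.of_discrete (s := {u : TreeVertex K | v <+: u})))

theorem branchFunction_le (v : TreeVertex K) (ψ : ℝ → ℝ≥0∞) (w : RegularTree K) :
    branchFunction v ψ w ≤ ψ w.height := indicator_le_self' (fun _ _ => zero_le) _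

section

variable {v : TreeVertex K} {φ : ℝ → ℝ≥0∞} {a h : ℝ}

theorem potential_branchFunction_le (hl : IsWeight lam) (hφ : Measurable φ)
    (z : RegularTree K) : potential lam (branchFunction v ((Ioc a h).indicator φ)) z ≤
      ∫⁻ t in Ioc a h, φ t ∂(lineMeasure lam) := by
  have hψ : Measurable ((Ioc a h).indicator φ) := hφ.indicator measurableSet_Ioc
  calc _ ≤ ∫⁻ w in Iic z, (Ioc a h).indicator φ w.height ∂(radialMeasure K lam) :=
        lintegral_mono fun w => branchFunction_le _ _ w
    _ = ∫⁻ t in Icc 0 z.height, (Ioc a h).indicator φ t ∂(lineMeasure lam) :=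
        setLIntegral_Iic hl.measurable hψ z
    _ ≤ ∫⁻ t, (Ioc a h).indicator φ t ∂(lineMeasure lam) := setLIntegral_le_lintegral _ _
    _ = _ := lintegral_indicator measurableSet_Ioc _

/-- By `hv`, a point of [0,z] at height above a already has the prefix v, so cutting off to the
branch loses nothing on this segment. -/
theorem potential_branchFunction_eq (hl : IsWeight lam) (hφ : Measurable φ) (ha : 0 ≤ a)
    (hv : ∀ t, a < t → v.length ≤ ⌈t⌉₊) {z : RegularTree K} (hvz : v <+: z.vertex)
    (hz : h ≤ z.height) : potential lam (branchFunction v ((Ioc a h).indicator φ)) z =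
      ∫⁻ t in Ioc a h, φ t ∂(lineMeasure lam) := by
  have hψ : Measurable ((Ioc a h).indicator φ) := hφ.indicator measurableSet_Ioc
  have hsub : Ioc a h ⊆ Icc 0 z.height := fun t ht => ⟨ha.trans ht.1.le, ht.2.trans hz⟩
  calc _ = ∫⁻ w in Iic z, (Ioc a h).indicator φ w.height ∂(radialMeasure K lam) := by
        refine setLIntegral_congr_fun (measurableSet_Iic_tree z) fun w hw => ?_
        by_cases hwa : w.height ∈ Ioc a h
        · refine indicator_of_mem (s := {w : RegularTree K | v <+: w.vertex}) ?_ _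
          exact List.prefix_of_prefix_length_le hvz (mem_Iic.1 hw).2
            (by rw [w.length_vertex]; exact hv _ hwa.1)
        · refine (le_antisymm ((branchFunction_le _ _ w).trans ?_) zero_le).trans
            (indicator_of_notMem hwa _).symm
          rw [indicator_of_notMem hwa]
    _ = ∫⁻ t in Icc 0 z.height, (Ioc a h).indicator φ t ∂(lineMeasure lam) :=
        setLIntegral_Iic hl.measurable hψ z
    _ = _ := by
        rw [lintegral_indicator measurableSet_Ioc, Measure.restrict_restrict measurableSet_Ioc,
          inter_eq_left.2 hsub]

theorem potential_branchFunction_eq_zero {z : RegularTree K}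
    (hz : v <+: z.vertex → z.height ≤ a) :
    potential lam (branchFunction v ((Ioc a h).indicator φ)) z = 0 := by
  rw [potential, ← lintegral_zero (μ := (radialMeasure K lam).restrict (Iic z))]
  refine setLIntegral_congr_fun (measurableSet_Iic_tree z) fun w hw => ?_
  have hw : w ≤ z := hw
  by_cases hvw : v <+: w.vertex
  · refine le_antisymm ((branchFunction_le _ _ w).trans ?_) zero_le
    rw [indicator_of_notMem]
    exact fun h => absurd (hw.1.trans (hz (hvw.trans hw.2))) (not_le.2 h.1)
  · exact indicator_of_notMem (s := {w : RegularTree K | v <+: w.vertex}) hvw _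

/-- The function lives below x, where the number of points of height t combines with μ/λ to
`heightDensity`. Only an upper bound is possible, since v may be a proper extension of the word of
x. -/
theorem lintegral_branchFunction_rpow_le (hl : IsWeight lam)
    (hm : IsWeight mu) (hp : 1 ≤ p) (hφ : Measurable φ) {x : RegularTree K}
    (hv : x.vertex <+: v) :
    ∫⁻ w, branchFunction v ((Ioc x.height h).indicator φ) w ^ p ∂(radialMeasure K mu) ≤
      ∫⁻ t in Icc x.height h, φ t ^ p * ENNReal.ofReal (heightDensity lam mu x t)
        ∂(lineMeasure lam) := by
  have hp0 : 0 < p := by linarith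
  have hψ : Measurable fun t => (Ioc x.height h).indicator φ t ^ p :=
    (hφ.indicator measurableSet_Ioc).pow_const p
  calc _ ≤ ∫⁻ w in Ici x, (Ioc x.height h).indicator φ w.height ^ p ∂(radialMeasure K mu) := by
        rw [← lintegral_indicator (measurableSet_Ici_tree x)]
        refine lintegral_mono fun w => ?_
        by_cases hvw : v <+: w.vertex ∧ w.height ∈ Ioc x.height h
        · rw [indicator_of_mem (show w ∈ Ici x from ⟨hvw.2.1.le, hv.trans hvw.1⟩)]
          exact ENNReal.rpow_le_rpow (branchFunction_le _ _ w) hp0.le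
        · have : branchFunction v ((Ioc x.height h).indicator φ) w = 0 := by
            by_cases h1 : v <+: w.vertex
            · refine le_antisymm ((branchFunction_le _ _ w).trans ?_) zero_le
              rw [indicator_of_notMem fun h2 => hvw ⟨h1, h2⟩]
            · exact indicator_of_notMem (s := {w : RegularTree K | v <+: w.vertex}) h1 _
          dsimp only
          rw [this, ENNReal.zero_rpow_of_pos hp0]
          exact zero_le
    _ = ∫⁻ t in Ici x.height, (Ioc x.height h).indicator φ t ^ p *
          ENNReal.ofReal (heightDensity lam mu x t) ∂(lineMeasure lam) := by
        rw [← setLIntegral_lineMeasure_heightDensity hl hm x hψ measurableSet_Ici Subset.rfl]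
        exact setLIntegral_Ici hm.measurable hψ x
    _ ≤ _ := by
        refine (setLIntegral_le_lintegral _ _).trans ?_
        rw [← lintegral_indicator measurableSet_Icc]
        refine lintegral_mono fun t => ?_
        by_cases ht : t ∈ Ioc x.height h
        · rw [indicator_of_mem ht, indicator_of_mem (Ioc_subset_Icc_self ht)]
        · rw [indicator_of_notMem ht, ENNReal.zero_rpow_of_pos hp0, zero_mul]; exact zero_le

end

/-- The Poincaré inequality for a fixed pair of constants. -/
def PoincareWith (K : ℕ) (lam mu : ℝ → ℝ) (p C σ : ℝ) : Prop :=
  ∀ (x : RegularTree K) (r : ℝ), 0 < r →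
    ∀ (u : RegularTree K → ℝ) (g : RegularTree K → ℝ≥0∞),
      IntegrableOn u (treeBall lam x (σ * r)) (radialMeasure K mu) → IsUpperGradient lam g u →
      ENNReal.ofReal (⨍ y in treeBall lam x r,
          |u y - ⨍ z in treeBall lam x r, u z ∂(radialMeasure K mu)| ∂(radialMeasure K mu)) ≤
        ENNReal.ofReal (C * r) *
          (⨍⁻ y in treeBall lam x (σ * r), g y ^ p ∂(radialMeasure K mu)) ^ (1 / p)

/-- Testing the Poincaré inequality with the potential of a radial function on a branch. -/
theorem lintegral_rpow_mul_measure_le (hK : 0 < K) (hl : IsWeight lam) (hm : IsWeight mu)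
    (hd : InfiniteDiameter K lam) (hp : 1 ≤ p)
    (hD : ∀ (x : RegularTree K) (r : ℝ), 0 < r → radialMeasure K mu (treeBall lam x (2 * r)) ≤
      D * radialMeasure K mu (treeBall lam x r)) {c σ : ℝ} (hc : 0 < c) (hσ : 1 ≤ σ)
    (hP : PoincareWith K lam mu p c σ) {x y : RegularTree K} {r : ℝ} (hr : 0 < r)
    (hcase : 2 ≤ K ∨ r ≤ 8 * arc lam x.height) (hy : arc lam y.height = arc lam x.height + r)
    {φ : ℝ → ℝ≥0∞} (hφ : Measurable φ) {N : ℕ} (hN : ∀ t, φ t ≤ N) :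
    (∫⁻ t in Icc x.height y.height, φ t ∂(lineMeasure lam)) ^ p *
        radialMeasure K mu (halfBall lam (upPoint lam x r) (2 * r)) ≤
      D * (4 * (D ^ 3 + D ^ 5) * ENNReal.ofReal c) ^ p * ENNReal.ofReal r ^ p *
        ∫⁻ t in Icc x.height y.height,
          φ t ^ p * ENNReal.ofReal (heightDensity lam mu x t) ∂(lineMeasure lam) := by
  have hp0 : 0 < p := by linarith
  have h2r : 0 < 2 * r := by linarith
  have hσr : 0 < σ * (2 * r) := by positivity
  obtain ⟨v, cZ, hxv, hv, hcZ, hZ⟩ := exists_branch_and_disjoint_ball hl hd x hr hcase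
  set h := y.height with hh
  set A := ∫⁻ t in Icc x.height h, φ t ∂(lineMeasure lam) with hA
  have hA' : A = ∫⁻ t in Ioc x.height h, φ t ∂(lineMeasure lam) :=
    (setLIntegral_congr Ioc_ae_eq_Icc).symm
  have hAt : A ≠ ∞ := by
    refine ((setLIntegral_mono' measurableSet_Icc fun t _ => hN t).trans_lt ?_).ne
    rw [setLIntegral_const]
    exact ENNReal.mul_lt_top (ENNReal.natCast_lt_top N)
      ((measure_mono (Icc_subset_Icc_left x.height_nonneg)).trans_lt (hl.lineMeasure_Icc_lt_top h))
  set E := ∫⁻ t in Icc x.height h,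
    φ t ^ p * ENNReal.ofReal (heightDensity lam mu x t) ∂(lineMeasure lam)
  set g := branchFunction (K := K) v ((Ioc x.height h).indicator φ)
  have hg : Measurable g := measurable_branchFunction v (hφ.indicator measurableSet_Ioc)
  have hUle : ∀ z, potential lam g z ≤ A := fun z => by
    rw [hA']; exact potential_branchFunction_le hl hφ z
  have hUfin : ∀ z, potential lam g z ≠ ∞ := fun z => ((hUle z).trans_lt hAt.lt_top).ne
  set u : RegularTree K → ℝ := fun z => (potential lam g z).toReal with hu
  have hgu : IsUpperGradient lam g u := isUpperGradient_potential hg hUfin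
  have hint : ∀ s, 0 < s → IntegrableOn u (treeBall lam x s) (radialMeasure K mu) := fun s hs =>
    Measure.integrableOn_of_bounded (M := A.toReal) (hl.measure_treeBall_lt_top hm hd x hs).ne
      (measurable_potential hg).ennreal_toReal.aestronglyMeasurable
      (Filter.Eventually.of_forall fun z => by
        rw [Real.norm_of_nonneg ENNReal.toReal_nonneg]
        exact ENNReal.toReal_mono hAt (hUle z))
  have hxh : x.height < h := (hl.arc_lt_iff x.height_nonneg y.height_nonneg).1 (by linarith)
  -- a ball on which `u` equals the full integral of `φ`
  obtain ⟨t, ht0, ht⟩ := hl.exists_arc_eq hd (s := arc lam x.height + 3 * r / 2)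
    (by linarith [arc_nonneg lam x.height])
  have hxt : x.height < t := (hl.arc_lt_iff x.height_nonneg ht0).1 (by linarith)
  -- cY lies in the branch at distance 3r/2 below x, so its ball of radius r/2 stays below the point
  -- at distance r from x, where φ has been integrated completely.
  obtain ⟨cY, hvY, hcY⟩ := exists_height_eq_of_prefix hK v ht0 (hv t hxt)
  have hxY : x ≤ cY := ⟨by rw [hcY]; exact hxt.le, hxv.trans hvY⟩
  have huY : ∀ z ∈ treeBall lam cY (r / 2), u z = A.toReal := by
    intro z hz
    have h1 := hl.upPoint_le_of_mem_treeBall hd (by linarith) hz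
    obtain ⟨h2, h3⟩ := hl.upPoint_spec hd cY (r := r / 2) (by linarith)
    rw [hcY, ht, min_eq_left (by linarith [arc_nonneg lam x.height])] at h3
    have h4 : (upPoint lam cY (r / 2)).height = h :=
      hl.arc_strictMonoOn.injOn (upPoint lam cY (r / 2)).height_nonneg y.height_nonneg
        (by rw [h3, hy]; ring)
    have h5 : v <+: (upPoint lam cY (r / 2)).vertex :=
      List.prefix_of_prefix_length_le hvY h2.2 (by
        rw [(upPoint lam cY (r / 2)).length_vertex, h4]; exact hv h hxh)
    simp only [hu, g]
    rw [potential_branchFunction_eq hl hφ x.height_nonneg hv (h5.trans h1.2) (h4 ▸ h1.1), hA']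
  have huZ : ∀ z ∈ treeBall lam cZ (r / 8), u z = 0 := by
    intro z hz
    simp only [hu, g]
    rw [potential_branchFunction_eq_zero (hZ z hz), ENNReal.toReal_zero]
  have hdY : treeDist lam x cY = 3 * r / 2 := by rw [hl.treeDist_of_le hxY, hcY, ht]; ring
  have hYB : treeBall lam cY (r / 2) ⊆ treeBall lam x (2 * r) :=
    hl.treeBall_subset_treeBall (by rw [hdY]; linarith)
  have hZB : treeBall lam cZ (r / 8) ⊆ treeBall lam x (2 * r) :=
    hl.treeBall_subset_treeBall (by linarith)
  -- Both enlarged radii are 4r, and the centres are at distances 3r/2 and at most r/4 from x. Three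
  -- and five doublings explain D^3 + D^5.
  have hBY : treeBall lam x (2 * r) ⊆ treeBall lam cY (2 ^ 3 * (r / 2)) :=
    hl.treeBall_subset_treeBall (by rw [treeDist_comm, hdY]; linarith)
  have hBZ : treeBall lam x (2 * r) ⊆ treeBall lam cZ (2 ^ 5 * (r / 8)) :=
    hl.treeBall_subset_treeBall (by rw [treeDist_comm]; linarith)
  set T := D ^ 3 + D ^ 5
  have key := ofReal_le_integral_abs_sub_average (T := T)
    (hl.measure_treeBall_pos hK hm hd x h2r).ne' (hl.measure_treeBall_lt_top hm hd x h2r).ne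
    (hint _ h2r) (hl.measurableSet_treeBall cY (r / 2)) (hl.measurableSet_treeBall cZ (r / 8))
    hYB hZB huY huZ
    ((measure_mono hBY).trans ((measure_treeBall_two_pow_mul_le hD cY (by linarith) 3).trans
      (mul_le_mul_left le_self_add _)))
    ((measure_mono hBZ).trans ((measure_treeBall_two_pow_mul_le hD cZ (by linarith) 5).trans
      (mul_le_mul_left le_add_self _)))
  rw [ENNReal.ofReal_toReal hAt] at key
  have hpo := hP x (2 * r) h2r u g (hint _ hσr) hgu
  rw [setLAverage_eq] at hpo
  have hV0 := (hl.measure_treeBall_pos hK hm hd x hσr).ne'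
  have hVt := (hl.measure_treeBall_lt_top hm hd x hσr).ne
  have hEle : ∫⁻ z in treeBall lam x (σ * (2 * r)), g z ^ p ∂(radialMeasure K mu) ≤ E :=
    (setLIntegral_le_lintegral _ _).trans (lintegral_branchFunction_rpow_le hl hm hp hφ hxv)
  have hF : radialMeasure K mu (halfBall lam (upPoint lam x r) (2 * r)) ≤
      D * radialMeasure K mu (treeBall lam x (σ * (2 * r))) := by
    have h1 : halfBall lam (upPoint lam x r) (2 * r) ⊆ treeBall lam x (2 * (2 * r)) := by
      intro z hz
      obtain ⟨h2, h3⟩ := hl.upPoint_spec hd x hr.le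
      have h4 := hl.treeDist_triangle x (upPoint lam x r) z
      rw [treeDist_comm x (upPoint lam x r), hl.treeDist_of_le h2] at h4
      change treeDist lam x z < 2 * (2 * r)
      linarith [min_le_left r (arc lam x.height), hz.2]
    have h2 : treeBall lam x (2 * r) ⊆ treeBall lam x (σ * (2 * r)) := fun z hz =>
      (show treeDist lam x z < 2 * r from hz).trans_le (le_mul_of_one_le_left h2r.le hσ)
    exact (measure_mono h1).trans ((hD x _ h2r).trans (mul_le_mul_right (measure_mono h2) _))
  set V := radialMeasure K mu (treeBall lam x (σ * (2 * r)))
  have hA1 : A ≤ 4 * T * ENNReal.ofReal c * ENNReal.ofReal r * (E / V) ^ (1 / p) := by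
    refine (key.trans (mul_le_mul_right hpo _)).trans ?_
    rw [ENNReal.ofReal_mul hc.le, ENNReal.ofReal_mul two_pos.le, ENNReal.ofReal_ofNat]
    calc _ ≤ 2 * T * (ENNReal.ofReal c * (2 * ENNReal.ofReal r) * (E / V) ^ (1 / p)) := by gcongr
      _ = 2 * 2 * T * ENNReal.ofReal c * ENNReal.ofReal r * (E / V) ^ (1 / p) := by ring
      _ = _ := by norm_num
  have hA2 : A ^ p ≤ (4 * T * ENNReal.ofReal c) ^ p * ENNReal.ofReal r ^ p * (E / V) := by
    have := ENNReal.rpow_le_rpow hA1 hp0.le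
    rwa [ENNReal.mul_rpow_of_nonneg _ _ hp0.le, ENNReal.mul_rpow_of_nonneg _ _ hp0.le,
      ← ENNReal.rpow_mul (E / V), one_div_mul_cancel hp0.ne', ENNReal.rpow_one] at this
  calc _ ≤ (4 * T * ENNReal.ofReal c) ^ p * ENNReal.ofReal r ^ p * (E / V) * (D * V) :=
        mul_le_mul' hA2 hF
    _ = D * (4 * T * ENNReal.ofReal c) ^ p * ENNReal.ofReal r ^ p * (E / V * V) := by ring
    _ = _ := by rw [ENNReal.div_mul_cancel hV0 hVt]

/-- The tested Poincaré inequality is exactly the hypothesis of the duality lemma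
`mul_dualFactor_le`, with m the mass of F(x̄^r,2r) and Q a multiple of r^p. -/
theorem exists_apQuantity_le (hK : 0 < K) (hl : IsWeight lam) (hm : IsWeight mu)
    (hd : InfiniteDiameter K lam) (hp : 1 ≤ p) (h : IsAdmissible K lam mu p) :
    ∃ Q : ℝ≥0∞, Q < ∞ ∧ ∀ (x : RegularTree K) (r : ℝ), 0 < r →
      (2 ≤ K ∨ r ≤ 8 * arc lam x.height) → apQuantity lam mu p x r ≤ Q := by
  obtain ⟨⟨d, _, hD⟩, c, σ, hc, hσ, hP⟩ := h
  set D := ENNReal.ofReal d with hDdef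
  have hDt : D ≠ ∞ := ENNReal.ofReal_ne_top
  refine ⟨D * (4 * (D ^ 3 + D ^ 5) * ENNReal.ofReal c) ^ p, ?_, fun x r hr hcase => ?_⟩
  · refine ENNReal.mul_lt_top hDt.lt_top (ENNReal.rpow_lt_top_of_nonneg (by linarith) ?_)
    exact ENNReal.mul_ne_top (ENNReal.mul_ne_top (by norm_num)
      (ENNReal.add_ne_top.2 ⟨ENNReal.pow_ne_top hDt, ENNReal.pow_ne_top hDt⟩)) ENNReal.ofReal_ne_top
  · obtain ⟨hxy, hy⟩ := hl.downPoint_spec hK hd x hr.le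
    rw [apQuantity_le_iff hl hm hp hr hxy]
    have h1 := mul_dualFactor_le hK hl hm hp
      (hl.measure_halfBall_pos hK hm hd (upPoint lam x r) (by linarith : 0 < 2 * r)).ne'
      (hl.measure_halfBall_lt_top hm hd (upPoint lam x r) (by linarith : 0 < 2 * r)).ne
      fun φ hφ ⟨N, hN⟩ => lintegral_rpow_mul_measure_le hK hl hm hd hp hD hc hσ hP hr hcase hy hφ hN
    refine h1.trans (mul_le_mul_right ?_ _)
    rw [ENNReal.ofReal_rpow_of_pos hr]
    exact ENNReal.ofReal_le_ofReal (by linarith [Real.rpow_pos_of_pos hr p])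

/-! ### The equivalences for measurable positive weights -/

theorem isAdmissible_of_apQuantity_le (hK : 0 < K) (hl : IsWeight lam) (hm : IsWeight mu)
    (hd : InfiniteDiameter K lam) (hp : 1 ≤ p) {Q : ℝ≥0∞} (hQ : Q < ∞)
    (h : ∀ (x : RegularTree K) (r : ℝ), 0 < r →
      (2 ≤ K ∨ r ≤ 8 * arc lam x.height) → apQuantity lam mu p x r ≤ Q) :
    IsAdmissible K lam mu p := by
  have hH : ∀ (x : RegularTree K) (r : ℝ), 0 < r → (2 ≤ K ∨ r ≤ 8 * arc lam x.height) →
      HardyBound lam mu p (2 * Q) x r := fun x r hr hc =>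
    hardyBound_of_apQuantity_le hK hl hm hd hp hr (h x r hr hc)
  have hQt : 2 * Q ≠ ∞ := ENNReal.mul_ne_top (by norm_num) hQ.ne
  exact ⟨isDoublingTree_of_hardyBound hK hl hd hp hQt fun x r hr hc => hH x r hr (Or.inr hc),
    supportsPoincare_of_hardyBound hK hl hm hd hp hQt hH⟩

theorem iSup_lt_top_iff_exists {ι : Type*} {q : ι → ℝ → Prop} {F : ι → ℝ → ℝ≥0∞} :
    (⨆ (x : ι) (r : ℝ) (_ : q x r), F x r) < ∞ ↔ ∃ Q < ∞, ∀ x r, q x r → F x r ≤ Q :=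
  ⟨fun h => ⟨_, h, fun x r hq => le_iSup_of_le x (le_iSup_of_le r (le_iSup_of_le hq le_rfl))⟩,
    fun ⟨_, hQ, h⟩ => (iSup_le fun x => iSup_le fun r => iSup_le fun hq => h x r hq).trans_lt hQ⟩

theorem isAdmissible_iff_satisfiesApFarFromRoot (hK : K = 1) (hl : IsWeight lam) (hm : IsWeight mu)
    (hd : InfiniteDiameter K lam) (hp : 1 ≤ p) :
    IsAdmissible K lam mu p ↔ SatisfiesApFarFromRoot K lam mu p := by
  have hK0 : 0 < K := by omega
  have hK2 : ¬ 2 ≤ K := by omega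
  rw [SatisfiesApFarFromRoot, iSup_lt_top_iff_exists]
  simp only [hl.treeDist_root]
  constructor
  · intro h
    obtain ⟨Q, hQ, hle⟩ := exists_apQuantity_le hK0 hl hm hd hp h
    exact ⟨Q, hQ, fun x r hr => hle x r hr.1 (Or.inr hr.2)⟩
  · rintro ⟨Q, hQ, hle⟩
    exact isAdmissible_of_apQuantity_le hK0 hl hm hd hp hQ fun x r hr hc =>
      hle x r ⟨hr, hc.resolve_left hK2⟩

theorem isAdmissible_iff_satisfiesAp (hK : 2 ≤ K) (hl : IsWeight lam) (hm : IsWeight mu)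
    (hd : InfiniteDiameter K lam) (hp : 1 ≤ p) :
    IsAdmissible K lam mu p ↔ SatisfiesAp K lam mu p := by
  have hK0 : 0 < K := by omega
  rw [SatisfiesAp, iSup_lt_top_iff_exists (q := fun _ r => 0 < r)]
  constructor
  · intro h
    obtain ⟨Q, hQ, hle⟩ := exists_apQuantity_le hK0 hl hm hd hp h
    exact ⟨Q, hQ, fun x r hr => hle x r hr (Or.inl hK)⟩
  · rintro ⟨Q, hQ, hle⟩
    exact isAdmissible_of_apQuantity_le hK0 hl hm hd hp hQ fun x r hr _ => hle x r hr

/-! ### Reduction to measurable weights that are positive everywhere -/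

/-- A measurable representative, reset to 1 wherever it fails to be positive; on the half-line this
changes it only on a null set. -/
theorem exists_isWeight (hpos : ∀ t, 0 ≤ t → 0 < f t) (hf : LocallyIntegrableOn f (Ici 0)) :
    ∃ f', IsWeight f' ∧ f =ᵐ[volume.restrict (Ici 0)] f' := by
  have hm : AEStronglyMeasurable f (volume.restrict (Ici 0)) := hf.aestronglyMeasurable
  set f₀ := hm.mk f
  have hf₀ : Measurable f₀ := hm.stronglyMeasurable_mk.measurable
  have hae : f =ᵐ[volume.restrict (Ici 0)] fun t => if 0 < f₀ t then f₀ t else 1 := by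
    filter_upwards [hm.ae_eq_mk, ae_restrict_mem measurableSet_Ici] with t ht ht0
    have h1 : 0 < f₀ t := (hpos t ht0).trans_eq ht
    rw [if_pos h1]; exact ht
  refine ⟨_, ⟨Measurable.ite (measurableSet_lt measurable_const hf₀) hf₀ measurable_const,
    fun t => ?_, fun t ht => ?_⟩, hae⟩
  · split_ifs with h
    · exact h
    · exact one_pos
  · obtain ⟨s, hs, hi⟩ := hf t ht
    refine ⟨s ∩ Ici 0, Filter.inter_mem hs self_mem_nhdsWithin, ?_⟩
    refine (hi.mono_set inter_subset_left).congr_fun_ae ?_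
    exact ae_restrict_of_ae_restrict_of_subset inter_subset_right hae

theorem ae_lengthMeasure_of_ae {f' : ℝ → ℝ} (h : f =ᵐ[volume.restrict (Ici 0)] f') :
    ∀ᵐ x ∂(lengthMeasure K), f x.height = f' x.height := by
  rw [Filter.EventuallyEq, ae_restrict_iff' measurableSet_Ici] at h
  obtain ⟨N, hN, hNm, hN0⟩ := exists_measurable_superset_of_null (ae_iff.1 h)
  rw [ae_iff]
  refine measure_mono_null (t := height ⁻¹' N) (fun x hx => hN fun h => hx (h x.height_nonneg)) ?_
  rw [lengthMeasure, measurableEmbedding_coords.comap_apply]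
  refine measure_mono_null (t := univ ×ˢ N) ?_ (by rw [Measure.prod_prod, hN0, mul_zero])
  rintro _ ⟨x, hx, rfl⟩
  exact ⟨mem_univ _, hx⟩

theorem radialMeasure_congr {f' : ℝ → ℝ} (h : f =ᵐ[volume.restrict (Ici 0)] f') :
    radialMeasure K f = radialMeasure K f' :=
  withDensity_congr_ae ((ae_lengthMeasure_of_ae h).mono fun x hx => by dsimp only; rw [hx])

section congr

variable {lam' mu' : ℝ → ℝ}

theorem treeDist_congr (h : radialMeasure K lam = radialMeasure K lam') :
    treeDist (K := K) lam = treeDist lam' := by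
  funext z y
  rw [treeDist, treeDist, h]

theorem isAdmissible_congr (hl : radialMeasure K lam = radialMeasure K lam')
    (hm : radialMeasure K mu = radialMeasure K mu') :
    IsAdmissible K lam mu p ↔ IsAdmissible K lam' mu' p := by
  simp only [IsAdmissible, IsDoublingTree, SupportsPoincare, IsUpperGradient, treeBall, hl, hm,
    treeDist_congr hl]

/-- The distance functions agree everywhere, so the chosen points `upPoint` and `downPoint` are
literally the same; the density enters only through an integral or an essential supremum. -/
theorem apQuantity_congr (hl : lam =ᵐ[volume.restrict (Ici 0)] lam')
    (hm : mu =ᵐ[volume.restrict (Ici 0)] mu') (x : RegularTree K) (r : ℝ) :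
    apQuantity lam mu p x r = apQuantity lam' mu' p x r := by
  have hl' := radialMeasure_congr (K := K) hl
  have hb : ∀ᵐ w ∂(radialMeasure K lam'), branchDensity lam mu x w = branchDensity lam' mu' x w := by
    refine (withDensity_absolutelyContinuous _ _).ae_le ?_
    filter_upwards [ae_lengthMeasure_of_ae hl, ae_lengthMeasure_of_ae hm] with w h1 h2
    rw [branchDensity, branchDensity, h1, h2]
  simp only [apQuantity, halfBall, upPoint, downPoint, treeDist_congr hl', hl',
    radialMeasure_congr (K := K) hm]
  congr 2
  · exact essSup_congr_ae ((ae_restrict_of_ae hb).mono fun w hw => by dsimp only; rw [hw])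
  · congr 2
    exact lintegral_congr_ae ((ae_restrict_of_ae hb).mono fun w hw => by dsimp only; rw [hw])

end congr

end RegularTree

end

theorem theorem1p3 (K : ℕ) (p : ℝ) (hp : 1 ≤ p) (lam mu : ℝ → ℝ)
    (hlam_pos : ∀ t, 0 ≤ t → 0 < lam t) (hmu_pos : ∀ t, 0 ≤ t → 0 < mu t)
    (hlam : LocallyIntegrableOn lam (Ici 0)) (hmu : LocallyIntegrableOn mu (Ici 0))
    (hdiam : RegularTree.InfiniteDiameter K lam) :
    (K = 1 → (RegularTree.IsAdmissible K lam mu p ↔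
      RegularTree.SatisfiesApFarFromRoot K lam mu p)) ∧
    (2 ≤ K → (RegularTree.IsAdmissible K lam mu p ↔ RegularTree.SatisfiesAp K lam mu p)) := by
  obtain ⟨lam', hlw, hl⟩ := RegularTree.exists_isWeight hlam_pos hlam
  obtain ⟨mu', hmw, hm⟩ := RegularTree.exists_isWeight hmu_pos hmu
  have hl' := RegularTree.radialMeasure_congr (K := K) hl
  have hm' := RegularTree.radialMeasure_congr (K := K) hm
  have hd := RegularTree.treeDist_congr hl'
  rw [RegularTree.InfiniteDiameter, hd] at hdiam
  rw [RegularTree.isAdmissible_congr hl' hm']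
  simp only [RegularTree.SatisfiesApFarFromRoot, RegularTree.SatisfiesAp,
    RegularTree.apQuantity_congr hl hm, hd]
  exact ⟨fun hK => RegularTree.isAdmissible_iff_satisfiesApFarFromRoot hK hlw hmw hdiam hp,
    fun hK => RegularTree.isAdmissible_iff_satisfiesAp hK hlw hmw hdiam hp⟩
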